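/- A lattice polytope in $\mathbb{R}^d$ is the convex hull of finitely many points of $\mathbb{Z}^d$. A unimodular simplex is a simplex that is lattice equivalent to a standard simplex $\operatorname{conv}\{0,e_1,\dots,e_k\}\subset\mathbb{R}^k$, where the lattice is the set of integer points in its affine span (so it need not be full-dimensional). A unimodular triangulation of a lattice polytope $P$ is a finite simplicial complex with union $P$ all of whose maximal simplices are unimodular. Let $Q\subset\mathbb{R}^d$ and $P_i\subset\mathbb{R}^{d_i}$ ($i=1,\dots,n$) be lattice polytopes, and let $\phi=(\phi_1,\dots,\phi_n):\mathbb{R}^d\to\mathbb{R}^n$ be an affine map with $\phi(\mathbb{Z}^d)\subset\mathbb{Z}^n$ and $\phi_i\ge 0$ on $Q$ for all $i$. The semidirect product is $$Q\ltimes_\phi(P_1,\dots,P_n):=\operatorname{conv}\Bigl(\bigcup_{a\in Q}\{a\}\times\prod_{i=1}^n\phi_i(a)P_i\Bigr)\subset\mathbb{R}^d\times\prod_{i=1}^n\mathbb{R}^{d_i},$$ with lattice $\mathbb{Z}^d\times\prod_i\mathbb{Z}^{d_i}$. (1) Let $n=1$ and $P=P_1$. If $\mathcal{S}$ and $\mathcal{T}$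 are unimodular triangulations of $Q$ and $P$, then $Q\ltimes_\phi P$ has a unimodular triangulation that refines the pull-back $\pi^*\mathcal{S}$ of $\mathcal{S}$ by the projection $\pi:Q\ltimes_\phi P\to Q$. Here the cells of $\pi^*\mathcal{S}$ are the sets $(Q\ltimes_\phi P)\cap\pi^{-1}(F)$ for the maximal simplices $F$ of $\mathcal{S}$, and refining means that every simplex of the new triangulation lies in one of these cells. (2) If $Q,P_1,\dots,P_n$ admit unimodular triangulations, then $Q\ltimes_\phi(P_1,\dots,P_n)$ admits a unimodular triangulation. (3) In particular, let $Q\subset k\Delta^d$ be a lattice polytope, where $k\in\mathbb{N}$ and $\Delta^d=\{x\in\mathbb{R}^{d+1}:x\ge 0,\ \sum_i x_i=1\}$, and let $P_1,\dots,P_{d+1}$ be lattice polytopes. If $Q,P_1,\dots,P_{d+1}$ admit unimodular triangulations, then so does the nested polytope $$\operatorname{NP}(Q;P_1,\dots,P_{d+1}):=\operatorname{conv}\Bigl(\bigcup_{a\text{ a vertex of }Q}\{a\}\times\prod_{i=1}^{d+1}a_iP_i\Bigr).$$ No triangulation here is assumed to be regular. -/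

import Mathlib

open scoped Pointwise

/-- The lattice `ℤ^ι` inside `ℝ^ι`. -/
def integerLattice (ι : Type*) : AddSubgroup (ι → ℝ) :=
  AddSubgroup.pi Set.univ fun _ => (Int.castAddHom ℝ).range

/-- The lattice `ℤ^d × ∏ i, ℤ^(e i)` inside `ℝ^d × ∏ i, ℝ^(e i)`. -/
def productLattice (d : ℕ) {n : ℕ} (e : Fin n → ℕ) :
    AddSubgroup ((Fin d → ℝ) × (∀ i : Fin n, Fin (e i) → ℝ)) :=
  (integerLattice (Fin d)).prod
    (AddSubgroup.pi Set.univ fun i => integerLattice (Fin (e i)))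

/-- A lattice polytope: the convex hull of finitely many lattice points. -/
def IsLatticePolytope {E : Type*} [AddCommGroup E] [Module ℝ E]
    (L : AddSubgroup E) (P : Set E) : Prop :=
  ∃ V : Finset E, (V : Set E) ⊆ L ∧ P = convexHull ℝ (V : Set E)

/-- The finite set `s` is the vertex set of a unimodular simplex: some injective affine map from
`ℝ^k` sends the vertices `0, e₁, …, e_k` of the standard simplex onto `s` and identifies `ℤ^k` with
the lattice points in its image, the affine span of `s`. -/
def IsUnimodularSimplex {E : Type*} [AddCommGroup E] [Module ℝ E]
    (L : AddSubgroup E) (s : Finset E) : Prop :=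
  ∃ (k : ℕ) (f : (Fin k → ℝ) →ᵃ[ℝ] E), Function.Injective f ∧
    (∀ x, f x ∈ L ↔ x ∈ integerLattice (Fin k)) ∧
    f '' insert 0 (Set.range fun i : Fin k => (Pi.single i 1 : Fin k → ℝ)) = (s : Set E)

/-- `K` is a unimodular triangulation of `P`: a finite simplicial complex with union `P` all of
whose maximal simplices are unimodular. -/
structure IsUnimodularTriangulation {E : Type*} [AddCommGroup E] [Module ℝ E]
    (L : AddSubgroup E) (P : Set E) (K : Geometry.SimplicialComplex ℝ E) : Prop where
  finite : K.faces.Finite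
  space_eq : K.space = P
  unimodular : ∀ s ∈ K.facets, IsUnimodularSimplex L s

/-- The cells of the pull-back to `R`, along `π`, of the complex `S`: the intersections of `R` with
the prisms `π⁻¹(F)` over the maximal simplices `F` of `S`. -/
def pullbackCells {E F : Type*} [AddCommGroup E] [Module ℝ E] [AddCommGroup F] [Module ℝ F]
    (π : E →ₗ[ℝ] F) (R : Set E) (S : Geometry.SimplicialComplex ℝ F) : Set (Set E) :=
  {C | ∃ s ∈ S.facets, C = R ∩ π ⁻¹' convexHull ℝ (s : Set F)}

/-- The complex `K` refines a subdivision with the given cells: every simplex of `K` lies in one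
of the cells. -/
def Refines {E : Type*} [AddCommGroup E] [Module ℝ E]
    (K : Geometry.SimplicialComplex ℝ E) (cells : Set (Set E)) : Prop :=
  ∀ s ∈ K.faces, ∃ C ∈ cells, convexHull ℝ (s : Set E) ⊆ C

/-- The semidirect product `Q ⋉_φ (P₁, …, P_n)`, the convex hull of the sets
`{a} × ∏ i, φ_i(a) P_i` for `a ∈ Q`. -/
def semidirectProduct {d n : ℕ} {e : Fin n → ℕ} (Q : Set (Fin d → ℝ))
    (φ : (Fin d → ℝ) →ᵃ[ℝ] (Fin n → ℝ)) (P : ∀ i : Fin n, Set (Fin (e i) → ℝ)) :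
    Set ((Fin d → ℝ) × (∀ i : Fin n, Fin (e i) → ℝ)) :=
  convexHull ℝ (⋃ a ∈ Q, {a} ×ˢ Set.pi Set.univ fun i => φ a i • P i)

/-- The nested polytope `NP(Q; P₁, …, P_n)`, the convex hull of the sets `{a} × ∏ i, a_i P_i`
for `a` a vertex of `Q`. -/
def nestedPolytope {n : ℕ} {e : Fin n → ℕ} (Q : Set (Fin n → ℝ))
    (P : ∀ i : Fin n, Set (Fin (e i) → ℝ)) :
    Set ((Fin n → ℝ) × (∀ i : Fin n, Fin (e i) → ℝ)) :=
  convexHull ℝ (⋃ a ∈ Set.extremePoints ℝ Q, {a} ×ˢ Set.pi Set.univ fun i => a i • P i)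

/-- `φ` is an integer affine map that is nonnegative on `Q`. -/
structure IsAdmissibleMap {d n : ℕ} (Q : Set (Fin d → ℝ))
    (φ : (Fin d → ℝ) →ᵃ[ℝ] (Fin n → ℝ)) : Prop where
  integral : ∀ x ∈ integerLattice (Fin d), φ x ∈ integerLattice (Fin n)
  nonneg : ∀ a ∈ Q, ∀ i, 0 ≤ φ a i

/-! The problem is homogenized. A unimodular triangulation placed at height one spans a unimodular
fan, and a unimodular fan whose generators all lie at height one cuts out a unimodular triangulation
(`IsUnimodularTriangulation.exists_fan`, `IsUnimodularFan.exists_triangulation`). With `Φ j` the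
homogenization of `φ_j`, the cone over the semidirect product consists of the tuples of points `x`
in the cone over `Q` and `z j` in the cones over the `P j`, such that `z j` has height `Φ j x`. It
therefore suffices to give this fibre product a unimodular fan.

The engine is `IsUnimodularFan.exists_chimney`. If a linear `ψ` takes values `c i ∈ ℕ` on the
generators, the region `0 ≤ h ≤ ψ x` over the fan is subdivided with generators `p i + k u`, `0 ≤ k
≤ c i`. Once the generators are ordered, the total height `h` is distributed greedily over the
columns, and inside a column only two consecutive levels are used. This makes the weights unique,
and integral at lattice points.

To reach the fibre product, each `z j` is replaced by its coordinates `t` along the vertices of the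
triangulation of `P j`. Adding these coordinates one chimney at a time gives a fan on `t ≥ 0`, `∑ w,
t (j, w) ≤ Φ j x` (`exists_fan_below`). The subfan on which equality holds and the support of `t` is
a face for every `j` is carried injectively to the fibre product, and unimodularity of the factors
makes this map reflect lattice points (`exists_fan_fibreProduct`). Every cone built lies over a cone
of the fan of `Q`, which gives the refinement for any number of factors. Nested polytopes are the
case where `φ` is the identity. -/

/-! ### Unimodular fans -/

/-- Generators `p` and faces `F` form a unimodular simplicial fan with respect to `L`: nonnegative
combinations supported on faces are unique, and integral exactly on lattice points. -/
structure IsUnimodularFan {ι M : Type*} [Fintype ι] [AddCommGroup M] [Module ℝ M]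
    (L : AddSubgroup M) (p : ι → M) (F : Set (Set ι)) : Prop where
  empty_mem : ∅ ∈ F
  down : ∀ s ∈ F, ∀ t ⊆ s, t ∈ F
  mem_lattice : ∀ i, p i ∈ L
  inj : ∀ w w' : ι → ℝ, 0 ≤ w → 0 ≤ w' → Function.support w ∈ F → Function.support w' ∈ F →
    ∑ i, w i • p i = ∑ i, w' i • p i → w = w'
  integral : ∀ w : ι → ℝ, Function.support w ∈ F → ∑ i, w i • p i ∈ L → ∀ i, ∃ n : ℤ, w i = n

/-- The union of the cones of a fan. -/
def fanCone {ι M : Type*} [Fintype ι] [AddCommGroup M] [Module ℝ M]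
    (p : ι → M) (F : Set (Set ι)) : Set M :=
  {x | ∃ w : ι → ℝ, 0 ≤ w ∧ Function.support w ∈ F ∧ ∑ i, w i • p i = x}

/-! ### Weights on two consecutive levels of one column -/

section Fibre

variable {c : ℕ} {f g : Fin (c + 1) → ℝ} {m : ℕ}

/-- In `∑ j, (j - m) * f j` the level `m` contributes zero, so only the level `m + 1` survives, with
coefficient one. -/
theorem fibre_upper (hf : ∀ k, f k ≠ 0 → (k : ℕ) = m ∨ (k : ℕ) = m + 1) {k : Fin (c + 1)}
    (hk : (k : ℕ) = m + 1) : f k = ∑ j : Fin (c + 1), ((j : ℕ) : ℝ) * f j - m * ∑ j, f j := by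
  rw [Finset.mul_sum, ← Finset.sum_sub_distrib, Finset.sum_eq_single k]
  · rw [hk]; push_cast; ring
  · intro j _ hj
    by_cases h0 : f j = 0
    · simp [h0]
    · rcases hf j h0 with h | h
      · rw [h]; ring
      · exact absurd (Fin.ext (h.trans hk.symm)) hj
  · simp

theorem fibre_lower (hf : ∀ k, f k ≠ 0 → (k : ℕ) = m ∨ (k : ℕ) = m + 1) {k : Fin (c + 1)}
    (hk : (k : ℕ) = m) : f k = (m + 1) * ∑ j, f j - ∑ j : Fin (c + 1), ((j : ℕ) : ℝ) * f j := by
  rw [Finset.mul_sum, ← Finset.sum_sub_distrib, Finset.sum_eq_single k]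
  · rw [hk]; ring
  · intro j _ hj
    by_cases h0 : f j = 0
    · simp [h0]
    · rcases hf j h0 with h | h
      · exact absurd (Fin.ext (h.trans hk.symm)) hj
      · rw [h]; push_cast; ring
  · simp

theorem fibre_bounds (h0 : 0 ≤ f) (hf : ∀ k, f k ≠ 0 → (k : ℕ) = m ∨ (k : ℕ) = m + 1) :
    m * ∑ j, f j ≤ ∑ j : Fin (c + 1), ((j : ℕ) : ℝ) * f j ∧
      ∑ j : Fin (c + 1), ((j : ℕ) : ℝ) * f j ≤ (m + 1) * ∑ j, f j := by
  rw [Finset.mul_sum, Finset.mul_sum]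
  constructor <;> refine Finset.sum_le_sum fun j _ => ?_ <;> by_cases hj : f j = 0
  · simp [hj]
  · have := h0 j
    simp only [Pi.zero_apply] at this
    rcases hf j hj with h | h <;> simp only [h, Nat.cast_add, Nat.cast_one] <;> nlinarith
  · simp [hj]
  · have := h0 j
    simp only [Pi.zero_apply] at this
    rcases hf j hj with h | h <;> simp only [h, Nat.cast_add, Nat.cast_one] <;> nlinarith

/-- The point of this formula is that `m` does not occur in it. The level `m` need not be determined
by `f`, but the weights depend only on mass and moment, which yields uniqueness inside a column. -/
theorem fibre_eq_max (h0 : 0 ≤ f) (hf : ∀ k, f k ≠ 0 → (k : ℕ) = m ∨ (k : ℕ) = m + 1)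
    (k : Fin (c + 1)) :
    f k = max 0 (∑ j, f j - |∑ j : Fin (c + 1), ((j : ℕ) : ℝ) * f j - (k : ℕ) * ∑ j, f j|) := by
  obtain ⟨h1, h2⟩ := fibre_bounds h0 hf
  have hs : 0 ≤ ∑ j, f j := Finset.sum_nonneg fun j _ => h0 j
  have hk0 := h0 k
  simp only [Pi.zero_apply] at hk0
  rcases lt_trichotomy (k : ℕ) m with hk | hk | hk
  · have hz : f k = 0 := by by_contra h; rcases hf k h with h | h <;> omega
    have hk' : ((k : ℕ) : ℝ) + 1 ≤ m := by exact_mod_cast hk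
    rw [hz, max_eq_left]
    have := le_abs_self (∑ j : Fin (c + 1), ((j : ℕ) : ℝ) * f j - (k : ℕ) * ∑ j, f j)
    nlinarith
  · have := fibre_lower hf hk
    have hk' : ((k : ℕ) : ℝ) = m := by exact_mod_cast hk
    rw [hk', abs_of_nonneg (by linarith), max_eq_right] <;> linarith
  · rcases eq_or_ne (k : ℕ) (m + 1) with hk2 | hk2
    · have := fibre_upper hf hk2
      have hk' : ((k : ℕ) : ℝ) = m + 1 := by exact_mod_cast hk2
      rw [hk', abs_of_nonpos (by linarith), max_eq_right] <;> linarith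
    · have hz : f k = 0 := by by_contra h; rcases hf k h with h | h <;> omega
      have hk' : (m : ℝ) + 1 + 1 ≤ k := by exact_mod_cast (by omega : m + 1 + 1 ≤ (k : ℕ))
      rw [hz, max_eq_left]
      have := neg_abs_le (∑ j : Fin (c + 1), ((j : ℕ) : ℝ) * f j - (k : ℕ) * ∑ j, f j)
      nlinarith

theorem exists_fibre (c : ℕ) {l h : ℝ} (hh : 0 ≤ h) (hl : 0 ≤ l) (hc : h ≤ c * l) :
    ∃ f : Fin (c + 1) → ℝ, 0 ≤ f ∧ ∑ j, f j = l ∧ ∑ j : Fin (c + 1), ((j : ℕ) : ℝ) * f j = h ∧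
      ∃ m : ℕ, ∀ k, f k ≠ 0 → (k : ℕ) = m ∨ (k : ℕ) = m + 1 := by
  rcases Nat.eq_zero_or_pos c with rfl | hpos
  · refine ⟨fun _ => l, fun _ => hl, by simp, ?_, 0, fun k _ => by omega⟩
    simp at hc ⊢; linarith
  -- Locates the slice `[m * l, (m + 1) * l]` that contains `h`. Requiring `m < n` keeps `m + 1` a
  -- legal level, which is why `c = 0` is treated apart.
  · have key : ∀ n : ℕ, 0 < n → h ≤ n * l → ∃ m < n, m * l ≤ h ∧ h ≤ (m + 1) * l := by
      intro n
      induction n with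
      | zero => intro h; omega
      | succ n ih =>
        intro _ hn
        by_cases hlt : n * l ≤ h
        · exact ⟨n, by omega, hlt, by push_cast at hn; exact hn⟩
        · rcases Nat.eq_zero_or_pos n with rfl | h0
          · simp at hlt; linarith
          · obtain ⟨m, hm, h'⟩ := ih h0 (by linarith)
            exact ⟨m, by omega, h'⟩
    obtain ⟨m, hm, h1, h2⟩ := key c hpos hc
    let a : Fin (c + 1) := ⟨m, by omega⟩
    let b : Fin (c + 1) := ⟨m + 1, by omega⟩
    -- The two weights solve the linear system given by mass `l` and moment `h`.
    refine ⟨Pi.single a ((m + 1) * l - h) + Pi.single b (h - m * l), ?_, ?_, ?_, m, ?_⟩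
    · exact add_nonneg (Pi.single_nonneg.2 (by linarith)) (Pi.single_nonneg.2 (by linarith))
    · simp [Finset.sum_add_distrib]; ring
    · simp only [Pi.add_apply, mul_add, Finset.sum_add_distrib]
      rw [Finset.sum_eq_single a, Finset.sum_eq_single b]
      · simp [a, b]; ring
      · intro j _ hj; simp [hj]
      · simp
      · intro j _ hj; simp [hj]
      · simp
    · intro k hk
      by_contra hne
      push Not at hne
      have ha : k ≠ a := fun h => hne.1 (by rw [h])
      have hb : k ≠ b := fun h => hne.2 (by rw [h])
      simp [ha, hb] at hk

theorem fibre_mean_le (h0 : 0 ≤ f) : ∑ j : Fin (c + 1), ((j : ℕ) : ℝ) * f j ≤ c * ∑ j, f j := by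
  rw [Finset.mul_sum]
  refine Finset.sum_le_sum fun j _ => mul_le_mul_of_nonneg_right ?_ (h0 j)
  exact_mod_cast Nat.lt_succ_iff.1 j.2

theorem fibre_eq_top (h0 : 0 ≤ f) (h : ∑ j : Fin (c + 1), ((j : ℕ) : ℝ) * f j = c * ∑ j, f j)
    {k : Fin (c + 1)} (hk : f k ≠ 0) : (k : ℕ) = c := by
  have hle : ∀ j : Fin (c + 1), ((j : ℕ) : ℝ) ≤ c :=
    fun j => by exact_mod_cast Nat.lt_succ_iff.1 j.2
  rw [Finset.mul_sum] at h
  have := (Finset.sum_eq_sum_iff_of_le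
    (fun j _ => mul_le_mul_of_nonneg_right (hle j) (h0 j))).1 h k (Finset.mem_univ k)
  exact_mod_cast mul_right_cancel₀ hk this

theorem fibre_eq_bot (h0 : 0 ≤ f) (h : ∑ j : Fin (c + 1), ((j : ℕ) : ℝ) * f j = 0)
    {k : Fin (c + 1)} (hk : f k ≠ 0) : (k : ℕ) = 0 := by
  have := (Finset.sum_eq_zero_iff_of_nonneg
    (fun j _ => mul_nonneg (Nat.cast_nonneg _) (h0 j))).1 h k (Finset.mem_univ k)
  simpa [hk] using this

end Fibre

/-! ### Staircases: filling columns in order -/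

section Staircase

variable {ι : Type*} [LinearOrder ι]

theorem exists_greedy_filling (b : ι → ℝ) (hb : 0 ≤ b) (s : Finset ι) (h : ℝ) (h0 : 0 ≤ h)
    (hs : h ≤ ∑ i ∈ s, b i) :
    ∃ x : ι → ℝ, 0 ≤ x ∧ x ≤ b ∧ ∑ i ∈ s, x i = h ∧
      ∀ i ∈ s, ∀ j ∈ s, i < j → x i = b i ∨ x j = 0 := by
  induction s using Finset.induction_on_max generalizing h with
  | empty => exact ⟨0, le_rfl, hb, by simp at hs ⊢; linarith, by simp⟩
  | insert a s ha ih =>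
    have hn : a ∉ s := fun h => lt_irrefl _ (ha a h)
    have hne : ∀ i ∈ s, i ≠ a := fun i hi => (ha i hi).ne
    rw [Finset.sum_insert hn] at hs
    -- Either the earlier columns hold all of `h` and the last one stays empty, or they are filled
    -- to capacity and the last one takes the remainder.
    rcases le_total h (∑ i ∈ s, b i) with hle | hle
    · obtain ⟨x, hx0, hxb, hxs, hx⟩ := ih h h0 hle
      refine ⟨Function.update x a 0, ?_, ?_, ?_, ?_⟩
      · intro i; by_cases hi : i = a
        · subst hi; simp
        · simpa [hi] using hx0 i
      · intro i; by_cases hi : i = a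
        · subst hi; simpa using hb i
        · simpa [hi] using hxb i
      · rw [Finset.sum_insert hn, Function.update_self, zero_add, ← hxs]
        exact Finset.sum_congr rfl fun i hi => by simp [hne i hi]
      · intro i hi j hj hij
        rcases Finset.mem_insert.1 hj with rfl | hj
        · simp
        · have hi : i ∈ s := (Finset.mem_insert.1 hi).resolve_left
            fun h => (hij.trans (ha j hj)).ne h
          simpa [hne i hi, hne j hj] using hx i hi j hj hij
    · refine ⟨Function.update b a (h - ∑ i ∈ s, b i), ?_, ?_, ?_, ?_⟩
      · intro i; by_cases hi : i = a
        · subst hi; simpa using hle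
        · simpa [hi] using hb i
      · intro i; by_cases hi : i = a
        · subst hi; simp only [Function.update_self]; linarith
        · simp [hi]
      · rw [Finset.sum_insert hn, Function.update_self,
          Finset.sum_congr rfl (fun i hi => Function.update_of_ne (hne i hi) _ _)]
        ring
      · intro i hi j hj hij
        left
        have : i ≠ a := by
          rintro rfl
          rcases Finset.mem_insert.1 hj with rfl | hj
          · exact lt_irrefl _ hij
          · exact lt_asymm hij (ha j hj)
        simp [this]

/-- Sets of height vectors that fill the columns `0, …, c i` one after the other. -/
structure IsStaircase (c : ι → ℕ) (s : Set (Σ i, Fin (c i + 1))) : Prop where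
  ordered : ∀ x ∈ s, ∀ y ∈ s, x.1 < y.1 → (x.2 : ℕ) = c x.1 ∨ (y.2 : ℕ) = 0
  consecutive : ∀ i, ∃ m : ℕ, ∀ k : Fin (c i + 1), ⟨i, k⟩ ∈ s → (k : ℕ) = m ∨ (k : ℕ) = m + 1

variable {c : ι → ℕ} {w w' : (Σ i, Fin (c i + 1)) → ℝ}

/-- Passes from supports to column heights: a weight below the top level in column `i` forces every
later column to height zero. -/
theorem IsStaircase.full_or_empty (hw : IsStaircase c (Function.support w)) {i j : ι}
    (hij : i < j) :
    ∑ k : Fin (c i + 1), ((k : ℕ) : ℝ) * w ⟨i, k⟩ = c i * ∑ k, w ⟨i, k⟩ ∨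
      ∑ k : Fin (c j + 1), ((k : ℕ) : ℝ) * w ⟨j, k⟩ = 0 := by
  by_cases h : ∀ k, w ⟨i, k⟩ ≠ 0 → (k : ℕ) = c i
  · left
    rw [Finset.mul_sum]
    refine Finset.sum_congr rfl fun k _ => ?_
    by_cases hk : w ⟨i, k⟩ = 0
    · simp [hk]
    · rw [h k hk]
  · right
    push Not at h
    obtain ⟨k, hk, hkc⟩ := h
    refine Finset.sum_eq_zero fun k' _ => ?_
    by_cases hk' : w ⟨j, k'⟩ = 0
    · simp [hk']
    · have := (hw.ordered ⟨i, k⟩ hk ⟨j, k'⟩ hk' hij).resolve_left hkc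
      simp only at this
      simp [this]

variable [Fintype ι]

/-- Two greedy distributions of the same total must agree column by column. Otherwise one is smaller
in some column `i` and larger in some column `j`; in whichever staircase is smaller in the earlier
of the two, that column is full or the later one is empty, and both are impossible. Equal column
heights then determine the weights by `fibre_eq_max`. -/
theorem IsStaircase.unique (hw : IsStaircase c (Function.support w))
    (hw' : IsStaircase c (Function.support w')) (h0 : 0 ≤ w) (h0' : 0 ≤ w')
    (hl : ∀ i, ∑ k, w ⟨i, k⟩ = ∑ k, w' ⟨i, k⟩)
    (hh : ∑ i, ∑ k : Fin (c i + 1), ((k : ℕ) : ℝ) * w ⟨i, k⟩ =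
      ∑ i, ∑ k : Fin (c i + 1), ((k : ℕ) : ℝ) * w' ⟨i, k⟩) : w = w' := by
  have key : ∀ i, ∑ k : Fin (c i + 1), ((k : ℕ) : ℝ) * w ⟨i, k⟩ =
      ∑ k : Fin (c i + 1), ((k : ℕ) : ℝ) * w' ⟨i, k⟩ := by
    by_contra hne
    push Not at hne
    have hlt : ∀ (v v' : (Σ i, Fin (c i + 1)) → ℝ),
        ∑ i, ∑ k : Fin (c i + 1), ((k : ℕ) : ℝ) * v ⟨i, k⟩ =
          ∑ i, ∑ k : Fin (c i + 1), ((k : ℕ) : ℝ) * v' ⟨i, k⟩ →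
        (∃ i, ∑ k : Fin (c i + 1), ((k : ℕ) : ℝ) * v ⟨i, k⟩ ≠
          ∑ k : Fin (c i + 1), ((k : ℕ) : ℝ) * v' ⟨i, k⟩) →
        ∃ i, ∑ k : Fin (c i + 1), ((k : ℕ) : ℝ) * v ⟨i, k⟩ <
          ∑ k : Fin (c i + 1), ((k : ℕ) : ℝ) * v' ⟨i, k⟩ := by
      rintro v v' hv ⟨i, hi⟩
      by_contra! hcon
      exact hi (((Finset.sum_eq_sum_iff_of_le fun i _ => hcon i).1 hv.symm i
        (Finset.mem_univ i)).symm)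
    obtain ⟨i, hi⟩ := hlt w w' hh hne
    obtain ⟨j, hj⟩ := hlt w' w hh.symm (by obtain ⟨i, hi⟩ := hne; exact ⟨i, hi.symm⟩)
    have hnn : ∀ (v : (Σ i, Fin (c i + 1)) → ℝ), 0 ≤ v → ∀ i,
        0 ≤ ∑ k : Fin (c i + 1), ((k : ℕ) : ℝ) * v ⟨i, k⟩ :=
      fun v hv i => Finset.sum_nonneg fun k _ => mul_nonneg (Nat.cast_nonneg _) (hv _)
    have hle : ∀ (v : (Σ i, Fin (c i + 1)) → ℝ), 0 ≤ v → ∀ i,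
        ∑ k : Fin (c i + 1), ((k : ℕ) : ℝ) * v ⟨i, k⟩ ≤ c i * ∑ k, v ⟨i, k⟩ :=
      fun v hv i => fibre_mean_le fun k => hv ⟨i, k⟩
    rcases lt_trichotomy i j with hij | rfl | hij
    · rcases hw.full_or_empty hij with h | h
      · have := hle w' h0' i
        rw [← hl] at this
        linarith
      · have := hnn w' h0' j
        linarith
    · linarith
    · rcases hw'.full_or_empty hij with h | h
      · have := hle w h0 j
        rw [hl] at this
        linarith
      · have := hnn w h0 i
        linarith
  funext ⟨i, k⟩
  obtain ⟨m, hm⟩ := hw.consecutive i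
  obtain ⟨m', hm'⟩ := hw'.consecutive i
  rw [fibre_eq_max (f := fun k => w ⟨i, k⟩) (fun k => h0 _) hm k,
    fibre_eq_max (f := fun k => w' ⟨i, k⟩) (fun k => h0' _) hm' k, hl i, key i]

/-- At most one column is neither full nor empty. The others have integral heights, so the
exceptional height is integral by subtraction from the total, and the weights are integral
combinations of masses and heights. -/
theorem IsStaircase.integral (hw : IsStaircase c (Function.support w))
    (hl : ∀ i, ∃ n : ℤ, ∑ k, w ⟨i, k⟩ = n)
    (hh : ∃ n : ℤ, ∑ i, ∑ k : Fin (c i + 1), ((k : ℕ) : ℝ) * w ⟨i, k⟩ = n) (x : Σ i, Fin (c i + 1)) :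
    ∃ n : ℤ, w x = n := by
  have key : ∀ i, ∃ n : ℤ, ∑ k : Fin (c i + 1), ((k : ℕ) : ℝ) * w ⟨i, k⟩ = n := by
    choose a ha using hl
    obtain ⟨N, hN⟩ := hh
    intro i
    by_contra hi
    -- The condition `j ≠ i` sits under the existential so that `choose` gives a total function; the
    -- value at `i` is a dummy.
    have hothers : ∀ j, ∃ n : ℤ, j ≠ i → ∑ k : Fin (c j + 1), ((k : ℕ) : ℝ) * w ⟨j, k⟩ = n := by
      intro j
      rcases lt_trichotomy i j with hij | rfl | hij
      · rcases hw.full_or_empty hij with h | h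
        · exact absurd ⟨c i * a i, by rw [h, ha]; push_cast; rfl⟩ hi
        · exact ⟨0, fun _ => by rw [h]; simp⟩
      · exact ⟨0, fun h => absurd rfl h⟩
      · rcases hw.full_or_empty hij with h | h
        · exact ⟨c j * a j, fun _ => by rw [h, ha]; push_cast; rfl⟩
        · exact absurd ⟨0, by rw [h]; simp⟩ hi
    choose b hb using hothers
    refine hi ⟨N - ∑ j ∈ Finset.univ.erase i, b j, ?_⟩
    rw [← Finset.add_sum_erase _ _ (Finset.mem_univ i)] at hN
    push_cast
    rw [← hN, Finset.sum_congr rfl fun j hj => hb j (Finset.ne_of_mem_erase hj)]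
    ring
  obtain ⟨i, k⟩ := x
  obtain ⟨m, hm⟩ := hw.consecutive i
  obtain ⟨a, ha⟩ := hl i
  obtain ⟨b, hb⟩ := key i
  by_cases h0 : w ⟨i, k⟩ = 0
  · exact ⟨0, by simp [h0]⟩
  · rcases hm k h0 with hk | hk
    · refine ⟨(m + 1) * a - b, ?_⟩
      rw [fibre_lower (f := fun k => w ⟨i, k⟩) hm hk, ha, hb]
      push_cast; ring
    · refine ⟨b - m * a, ?_⟩
      rw [fibre_upper (f := fun k => w ⟨i, k⟩) hm hk, ha, hb]
      push_cast; ring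

theorem exists_staircase (c : ι → ℕ) (l : ι → ℝ) (hl : 0 ≤ l) (h : ℝ) (h0 : 0 ≤ h)
    (hc : h ≤ ∑ i, c i * l i) :
    ∃ w : (Σ i, Fin (c i + 1)) → ℝ, 0 ≤ w ∧ IsStaircase c (Function.support w) ∧
      (∀ i, ∑ k, w ⟨i, k⟩ = l i) ∧ ∑ i, ∑ k : Fin (c i + 1), ((k : ℕ) : ℝ) * w ⟨i, k⟩ = h := by
  obtain ⟨x, hx0, hxb, hxs, hx⟩ := exists_greedy_filling (fun i => c i * l i)
    (fun i => mul_nonneg (Nat.cast_nonneg _) (hl i)) Finset.univ h h0 hc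
  choose f hf0 hfl hfh hfm using fun i => exists_fibre (c i) (hx0 i) (hl i) (hxb i)
  refine ⟨fun y => f y.1 y.2, fun y => hf0 _ _, ⟨?_, ?_⟩, hfl, ?_⟩
  · rintro ⟨i, k⟩ hk ⟨j, k'⟩ hk' hij
    rcases hx i (Finset.mem_univ i) j (Finset.mem_univ j) hij with h | h
    · exact .inl (fibre_eq_top (hf0 i) (by rw [hfh, h, hfl]) hk)
    · exact .inr (fibre_eq_bot (hf0 j) (by rw [hfh, h]) hk')
  · exact fun i => hfm i
  · simp only [hfh, hxs]

end Staircase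

/-! ### Chimneys over a unimodular fan -/

section Chimney

variable {ι M : Type*} [Fintype ι] [AddCommGroup M] [Module ℝ M]

theorem sum_sigma_height (c : ι → ℕ) (p : ι → M) (u : M) (w : (Σ i, Fin (c i + 1)) → ℝ) :
    ∑ x, w x • (p x.1 + ((x.2 : ℕ) : ℝ) • u) =
      ∑ i, (∑ k, w ⟨i, k⟩) • p i +
        (∑ i, ∑ k : Fin (c i + 1), ((k : ℕ) : ℝ) * w ⟨i, k⟩) • u := by
  rw [Fintype.sum_sigma]
  simp only [smul_add, Finset.sum_add_distrib, Finset.sum_smul, smul_smul, mul_comm]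

theorem support_fibre_sum_subset {ι : Type*} (c : ι → ℕ) (w : (Σ i, Fin (c i + 1)) → ℝ) :
    Function.support (fun i => ∑ k, w ⟨i, k⟩) ⊆ Sigma.fst '' Function.support w := by
  intro i hi
  obtain ⟨k, -, hk⟩ := Finset.exists_ne_zero_of_sum_ne_zero hi
  exact ⟨⟨i, k⟩, hk, rfl⟩

theorem generator_mem_fanCone {L : AddSubgroup M} {p : ι → M} {F : Set (Set ι)}
    (hF : IsUnimodularFan L p F) {i : ι} (hi : {i} ∈ F) : p i ∈ fanCone p F := by
  classical
  refine ⟨Pi.single i 1, Pi.single_nonneg.2 zero_le_one, hF.down _ hi _ ?_, ?_⟩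
  · exact Pi.support_single_subset
  · rw [Finset.sum_eq_single i] <;> simp +contextual

/-- The region below a linear function over the cone of a unimodular fan has a unimodular fan that
projects to the given one. -/
theorem IsUnimodularFan.exists_chimney {L : AddSubgroup M} {p : ι → M} {F : Set (Set ι)}
    (hF : IsUnimodularFan L p F) (c : ι → ℕ) (ψ : M →ₗ[ℝ] ℝ) (hψ : ∀ i, ψ (p i) = c i)
    {u : M} (hu : u ∈ L) (ℓ : M →ₗ[ℝ] ℝ) (hℓu : ℓ u = 1) (hℓp : ∀ i, ℓ (p i) = 0)
    (hℓL : ∀ x ∈ L, ∃ n : ℤ, ℓ x = n) :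
    ∃ F' : Set (Set (Σ i, Fin (c i + 1))),
      IsUnimodularFan L (fun x => p x.1 + ((x.2 : ℕ) : ℝ) • u) F' ∧
      (∀ s ∈ F', Sigma.fst '' s ∈ F) ∧
      (∀ x, {x.1} ∈ F → {x} ∈ F') ∧
      fanCone (fun x : Σ i, Fin (c i + 1) => p x.1 + ((x.2 : ℕ) : ℝ) • u) F' =
        {y | ∃ x ∈ fanCone p F, ∃ h : ℝ, 0 ≤ h ∧ h ≤ ψ x ∧ x + h • u = y} := by
  -- Any linear order on the generators will do; it only fixes the order in which columns are
  -- filled.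
  let _ : LinearOrder ι := LinearOrder.lift' (Fintype.equivFin ι) (Equiv.injective _)
  have hℓ : ∀ w : (Σ i, Fin (c i + 1)) → ℝ, ℓ (∑ x, w x • (p x.1 + ((x.2 : ℕ) : ℝ) • u)) =
      ∑ i, ∑ k : Fin (c i + 1), ((k : ℕ) : ℝ) * w ⟨i, k⟩ := by
    intro w
    rw [sum_sigma_height, map_add, map_smul, hℓu, map_sum]
    simp [hℓp]
  have hsupp : ∀ w : (Σ i, Fin (c i + 1)) → ℝ, Sigma.fst '' Function.support w ∈ F →
      Function.support (fun i => ∑ k, w ⟨i, k⟩) ∈ F :=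
    fun w h => hF.down _ h _ (support_fibre_sum_subset c w)
  have hnn : ∀ w : (Σ i, Fin (c i + 1)) → ℝ, 0 ≤ w → 0 ≤ fun i => ∑ k, w ⟨i, k⟩ :=
    fun w h i => Finset.sum_nonneg fun k _ => h _
  -- A face is a staircase standing over a face of the base. The functional `ℓ` recovers the total
  -- height, so base point and height can be compared separately.
  refine ⟨{s | Sigma.fst '' s ∈ F ∧ IsStaircase c s}, ⟨?_, ?_, ?_, ?_, ?_⟩, fun s hs => hs.1,
    ?_, ?_⟩
  · refine ⟨by simpa using hF.empty_mem, by simp, fun i => ⟨0, by simp⟩⟩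
  · rintro s ⟨hs, hs'⟩ t hts
    refine ⟨hF.down _ hs _ (Set.image_mono hts),
      fun x hx y hy => hs'.ordered x (hts hx) y (hts hy), fun i => ?_⟩
    obtain ⟨m, hm⟩ := hs'.consecutive i
    exact ⟨m, fun k hk => hm k (hts hk)⟩
  · intro x
    refine L.add_mem (hF.mem_lattice _) ?_
    rw [Nat.cast_smul_eq_nsmul]
    exact L.nsmul_mem hu _
  · rintro w w' h0 h0' ⟨hs, hst⟩ ⟨hs', hst'⟩ heq
    have hh := congrArg ℓ heq
    rw [hℓ, hℓ] at hh
    rw [sum_sigma_height, sum_sigma_height, hh, add_left_inj] at heq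
    have := hF.inj _ _ (hnn w h0) (hnn w' h0') (hsupp w hs) (hsupp w' hs') heq
    exact hst.unique hst' h0 h0' (fun i => congrFun this i) hh
  · rintro w ⟨hs, hst⟩ hL
    obtain ⟨n, hn⟩ := hℓL _ hL
    rw [hℓ] at hn
    rw [sum_sigma_height, hn, Int.cast_smul_eq_zsmul,
      L.add_mem_cancel_right (L.zsmul_mem hu n)] at hL
    exact hst.integral (hF.integral _ (hsupp w hs) hL) ⟨n, hn⟩
  · rintro ⟨i, k⟩ hx
    refine ⟨by simpa using hx, ?_, ?_⟩
    · rintro x rfl y rfl hxy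
      exact absurd hxy (lt_irrefl _)
    · refine fun j => ⟨k, fun k' hk' => .inl ?_⟩
      obtain ⟨rfl, h⟩ := Sigma.mk.inj_iff.1 (Set.mem_singleton_iff.1 hk')
      rw [eq_of_heq h]
  · have hψs : ∀ l : ι → ℝ, ψ (∑ i, l i • p i) = ∑ i, c i * l i := by
      intro l
      simp [map_sum, hψ, mul_comm]
    ext y
    constructor
    · rintro ⟨w, h0, ⟨hs, hst⟩, rfl⟩
      refine ⟨_, ⟨_, hnn w h0, hsupp w hs, rfl⟩, _, ?_, ?_, (sum_sigma_height c p u w).symm⟩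
      · exact Finset.sum_nonneg fun i _ => Finset.sum_nonneg fun k _ =>
          mul_nonneg (Nat.cast_nonneg _) (h0 _)
      · rw [hψs]
        exact Finset.sum_le_sum fun i _ => fibre_mean_le fun k => h0 _
    · rintro ⟨x, ⟨l, hl0, hlF, rfl⟩, h, h0, hle, rfl⟩
      rw [hψs] at hle
      obtain ⟨w, hw0, hst, hwl, hwh⟩ := exists_staircase c l hl0 h h0 hle
      refine ⟨w, hw0, ⟨?_, hst⟩, ?_⟩
      -- A column that carries a nonzero weight has positive mass, because the weights are
      -- nonnegative; hence it lies in the support of `l`.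
      · refine hF.down _ hlF _ ?_
        rintro _ ⟨⟨i, k⟩, hk, rfl⟩
        rw [Function.mem_support, ← hwl i]
        refine (lt_of_lt_of_le (lt_of_le_of_ne (hw0 _) (Ne.symm hk))
          (Finset.single_le_sum (f := fun k => w ⟨i, k⟩) (fun k _ => hw0 _)
            (Finset.mem_univ k))).ne'
      · rw [sum_sigma_height, hwh]
        simp only [hwl]

end Chimney

/-! ### Integer lattices and linear images of fans -/

theorem mem_integerLattice {κ : Type*} {x : κ → ℝ} :
    x ∈ integerLattice κ ↔ ∀ i, ∃ n : ℤ, x i = n := by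
  simp only [integerLattice, AddSubgroup.mem_pi, Set.mem_univ, forall_const,
    AddMonoidHom.mem_range, Int.coe_castAddHom, eq_comm]

/-- A subfan of a unimodular fan stays unimodular under a linear map that is injective on its cone
and reflects lattice points. -/
theorem IsUnimodularFan.map {ι M M' : Type*} [Fintype ι] [AddCommGroup M] [Module ℝ M]
    [AddCommGroup M'] [Module ℝ M'] {L : AddSubgroup M} {p : ι → M} {F : Set (Set ι)}
    (hF : IsUnimodularFan L p F) {G : Set (Set ι)} (hGF : G ⊆ F) (h0 : ∅ ∈ G)
    (hG : ∀ s ∈ G, ∀ t ⊆ s, t ∈ G) (g : M →ₗ[ℝ] M') {L' : AddSubgroup M'}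
    (hg : ∀ i, g (p i) ∈ L') (hinj : Set.InjOn g (fanCone p G))
    (hint : ∀ w : ι → ℝ, Function.support w ∈ G → g (∑ i, w i • p i) ∈ L' → ∑ i, w i • p i ∈ L) :
    IsUnimodularFan L' (fun i => g (p i)) G ∧
      fanCone (fun i => g (p i)) G = g '' fanCone p G := by
  have hsum : ∀ w : ι → ℝ, ∑ i, w i • g (p i) = g (∑ i, w i • p i) := fun w => by simp [map_sum]
  refine ⟨⟨h0, hG, hg, ?_, ?_⟩, ?_⟩
  · intro w w' hw hw' hs hs' heq
    rw [hsum, hsum] at heq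
    exact hF.inj w w' hw hw' (hGF hs) (hGF hs')
      (hinj ⟨w, hw, hs, rfl⟩ ⟨w', hw', hs', rfl⟩ heq)
  · intro w hs hL
    rw [hsum] at hL
    exact hF.integral w (hGF hs) (hint w hs hL)
  · ext y
    constructor
    · rintro ⟨w, hw, hs, rfl⟩
      exact ⟨_, ⟨w, hw, hs, rfl⟩, (hsum w).symm⟩
    · rintro ⟨_, ⟨w, hw, hs, rfl⟩, rfl⟩
      exact ⟨w, hw, hs, hsum w⟩

/-! ### Fibre products of fans -/

section Product

variable {ι₀ N : Type} [Fintype ι₀]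
  [AddCommGroup N] [Module ℝ N] {L₀ : AddSubgroup N} {p₀ : ι₀ → N} {F₀ : Set (Set ι₀)}

/-- The coordinates in `A` are switched on one at a time, each by a chimney in its own direction.
The invariants that all singletons are faces and that faces lie over faces of `F₀` are carried
along, so that generators stay in the cone and the refinement survives. -/
theorem exists_fan_below {J : Type} [Finite J] {W : J → Type} [∀ j, Fintype (W j)]
    (hF₀ : IsUnimodularFan L₀ p₀ F₀) (hs₀ : ∀ i, {i} ∈ F₀)
    (φ : J → N →ₗ[ℝ] ℝ) (hφ : ∀ j i, ∃ n : ℕ, φ j (p₀ i) = n) (A : Finset (Σ j, W j)) :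
    ∃ (ι : Type) (_ : Fintype ι) (p : ι → N × ((Σ j, W j) → ℝ)) (F : Set (Set ι)),
      IsUnimodularFan (L₀.prod (integerLattice (Σ j, W j))) p F ∧ (∀ i, {i} ∈ F) ∧
      (∀ s ∈ F, ∃ s₀ ∈ F₀, ∀ i ∈ s, ∃ i₀ ∈ s₀, (p i).1 = p₀ i₀) ∧
      fanCone p F = {y | y.1 ∈ fanCone p₀ F₀ ∧ 0 ≤ y.2 ∧ (∀ a ∉ A, y.2 a = 0) ∧
        ∀ j, ∑ w, y.2 ⟨j, w⟩ ≤ φ j y.1} := by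
  classical
  induction A using Finset.induction_on with
  | empty =>
    obtain ⟨hF, hc⟩ := hF₀.map subset_rfl hF₀.empty_mem hF₀.down
      (LinearMap.inl ℝ N ((Σ j, W j) → ℝ)) (L' := L₀.prod (integerLattice (Σ j, W j)))
      (fun i => ⟨hF₀.mem_lattice i, AddSubgroup.zero_mem _⟩)
      (LinearMap.inl_injective.injOn) (fun w _ h => h.1)
    refine ⟨ι₀, inferInstance, _, F₀, hF, hs₀, fun s hs => ⟨s, hs, fun i hi => ⟨i, hi, rfl⟩⟩, ?_⟩
    rw [hc]
    ext ⟨x, t⟩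
    constructor
    · rintro ⟨x, hx, h⟩
      obtain ⟨rfl, rfl⟩ := Prod.mk_inj.1 h
      refine ⟨hx, le_rfl, fun _ _ => rfl, fun j => ?_⟩
      obtain ⟨w, hw, -, rfl⟩ := hx
      have h0 : 0 ≤ φ j (∑ i, w i • p₀ i) := by
        rw [map_sum]
        refine Finset.sum_nonneg fun i _ => ?_
        obtain ⟨n, hn⟩ := hφ j i
        rw [map_smul, hn]
        exact mul_nonneg (hw i) n.cast_nonneg
      exact Finset.sum_const_zero.le.trans h0
    · rintro ⟨hx, -, ht, -⟩
      exact ⟨x, hx, Prod.ext rfl (funext fun a => (ht a (Finset.notMem_empty a)).symm)⟩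
  | insert a A ha ih =>
    obtain ⟨ι, _, p, F, hF, hs, hproj, hcone⟩ := ih
    obtain ⟨j, w⟩ := a
    -- The roof of the chimney is the slack left in block `j`. On generators it is nonnegative by
    -- the description of the cone and integral by the lattice conditions, hence a natural number.
    let ψ : N × ((Σ j, W j) → ℝ) →ₗ[ℝ] ℝ := φ j ∘ₗ LinearMap.fst ℝ _ _ -
      ∑ w, LinearMap.proj ⟨j, w⟩ ∘ₗ LinearMap.snd ℝ _ _
    have hψ : ∀ y, ψ y = φ j y.1 - ∑ w, y.2 ⟨j, w⟩ := fun y => by simp [ψ]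
    have hgen : ∀ i, (p i) ∈ fanCone p F := fun i => generator_mem_fanCone hF (hs i)
    have hnat : ∀ i, ∃ n : ℕ, ψ (p i) = n := by
      intro i
      have hmem := hgen i
      rw [hcone] at hmem
      have hnn : 0 ≤ ψ (p i) := by rw [hψ]; linarith [hmem.2.2.2 j]
      obtain ⟨s₀, -, h⟩ := hproj _ (hs i)
      obtain ⟨i₀, -, h⟩ := h i rfl
      obtain ⟨m, hm⟩ := hφ j i₀
      choose n hn using mem_integerLattice.1 (hF.mem_lattice i).2
      have hz : ψ (p i) = ((m - ∑ w, n ⟨j, w⟩ : ℤ) : ℝ) := by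
        rw [hψ, h, hm]
        push_cast
        simp only [hn]
      rw [hz] at hnn ⊢
      obtain ⟨k, hk⟩ := Int.eq_ofNat_of_zero_le (Int.cast_nonneg_iff.1 hnn)
      exact ⟨k, by rw [hk]; simp⟩
    choose c hc using hnat
    have hzero : ∀ y ∈ fanCone p F, y.2 ⟨j, w⟩ = 0 := fun y hy => by
      rw [hcone] at hy
      exact hy.2.2.1 _ ha
    obtain ⟨F', hF', hproj', hs', hcone'⟩ := hF.exists_chimney c ψ hc
      (u := ((0 : N), Pi.single (⟨j, w⟩ : Σ j, W j) (1 : ℝ)))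
      ⟨AddSubgroup.zero_mem _, mem_integerLattice.2 fun b => by
        by_cases hb : b = ⟨j, w⟩
        · exact ⟨1, by rw [hb]; simp⟩
        · exact ⟨0, by simp [hb]⟩⟩
      (LinearMap.proj (⟨j, w⟩ : Σ j, W j) ∘ₗ LinearMap.snd ℝ _ _) (by simp)
      (fun i => hzero _ (hgen i)) (fun x hx => mem_integerLattice.1 hx.2 _)
    refine ⟨_, inferInstance, _, F', hF', fun x => hs' x (hs _), ?_, ?_⟩
    · intro s hs
      obtain ⟨s₀, hs₀, h⟩ := hproj _ (hproj' s hs)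
      refine ⟨s₀, hs₀, fun i hi => ?_⟩
      obtain ⟨i₀, hi₀, h⟩ := h i.1 ⟨i, hi, rfl⟩
      exact ⟨i₀, hi₀, by simp [h]⟩
    · rw [hcone']
      ext ⟨x, t⟩
      constructor
      · rintro ⟨⟨x', t'⟩, hy, h, h0, hle, heq⟩
        have hz := hzero _ hy
        rw [hcone] at hy
        rw [hψ] at hle
        obtain ⟨hx, ht0, htA, hts⟩ := hy
        simp only [Prod.smul_mk, smul_zero, Prod.mk_add_mk, add_zero, Prod.mk.injEq] at heq
        obtain ⟨rfl, rfl⟩ := heq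
        refine ⟨hx, add_nonneg ht0 (smul_nonneg h0 (Pi.single_nonneg.2 zero_le_one)), ?_, ?_⟩
        · intro b hb
          rw [Finset.mem_insert, not_or] at hb
          have := htA b hb.2
          simp only at this
          simp [this, hb.1]
        · intro j'
          have hj := hts j'
          simp only at hj hle ⊢
          by_cases hjj : j' = j
          · subst hjj
            have h1 : ∑ w', (h • Pi.single (⟨j', w⟩ : Σ j, W j) (1 : ℝ) : (Σ j, W j) → ℝ) ⟨j', w'⟩
                = h := by
              rw [Finset.sum_eq_single w]
              · simp
              · intro w' _ hw'; simp [hw']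
              · simp
            simp only [Pi.add_apply, Finset.sum_add_distrib, h1]
            linarith
          · have h1 : ∀ w', (Pi.single (⟨j, w⟩ : Σ j, W j) (1 : ℝ) : (Σ j, W j) → ℝ) ⟨j', w'⟩ = 0 :=
              fun w' => Pi.single_eq_of_ne (fun h => hjj (congrArg Sigma.fst h)) _
            simpa [h1] using hj
      · rintro ⟨hx, ht0, htA, hts⟩
        simp only at hx ht0 htA hts
        have hsum : ∀ j', ∑ w', Function.update t ⟨j, w⟩ 0 ⟨j', w'⟩ ≤ ∑ w', t ⟨j', w'⟩ := by
          intro j'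
          refine Finset.sum_le_sum fun w' _ => ?_
          by_cases h : (⟨j', w'⟩ : Σ j, W j) = ⟨j, w⟩
          · rw [h, Function.update_self]; exact ht0 _
          · rw [Function.update_of_ne h]
        -- The base point is obtained by erasing the new coordinate, and the erased value is the
        -- height in the chimney.
        refine ⟨(x, Function.update t ⟨j, w⟩ 0), ?_, t ⟨j, w⟩, ht0 _, ?_, ?_⟩
        · rw [hcone]
          refine ⟨hx, ?_, ?_, fun j' => (hsum j').trans (hts j')⟩
          · intro b
            by_cases h : b = ⟨j, w⟩
            · simp [h]
            · simpa [h] using ht0 b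
          · intro b hb
            by_cases h : b = ⟨j, w⟩
            · simp [h]
            · simpa [h] using htA b (by simp [h, hb])
        · rw [hψ]
          have h1 : ∑ w', Function.update t ⟨j, w⟩ 0 ⟨j, w'⟩ = ∑ w', t ⟨j, w'⟩ - t ⟨j, w⟩ := by
            rw [← Finset.add_sum_erase _ _ (Finset.mem_univ w),
              ← Finset.add_sum_erase _ (fun w' => t ⟨j, w'⟩) (Finset.mem_univ w),
              Function.update_self, zero_add, add_sub_cancel_left]
            exact Finset.sum_congr rfl fun w' hw' =>
              Function.update_of_ne (fun h => (Finset.ne_of_mem_erase hw') (by simpa using h)) _ _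
          have := hts j
          simp only [h1]
          linarith
        · refine Prod.ext (by simp) (funext fun b => ?_)
          by_cases h : b = ⟨j, w⟩
          · subst h; simp
          · simp [h]

variable {J : Type} {W : J → Type} [Fintype J] [∀ j, Fintype (W j)]
  {N' : J → Type} [∀ j, AddCommGroup (N' j)] [∀ j, Module ℝ (N' j)]
  {L' : ∀ j, AddSubgroup (N' j)} {q : ∀ j, W j → N' j} {T : ∀ j, Set (Set (W j))}

/-- The fibre product of a unimodular fan with unimodular fans that are generated in height one
has a unimodular fan. -/
theorem exists_fan_fibreProduct (hF₀ : IsUnimodularFan L₀ p₀ F₀) (hs₀ : ∀ i, {i} ∈ F₀)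
    (φ : J → N →ₗ[ℝ] ℝ) (hφ : ∀ j i, ∃ n : ℕ, φ j (p₀ i) = n)
    (hT : ∀ j, IsUnimodularFan (L' j) (q j) (T j)) (δ : ∀ j, N' j →ₗ[ℝ] ℝ)
    (hδ : ∀ j w, δ j (q j w) = 1) :
    ∃ (ι : Type) (_ : Fintype ι) (p : ι → N × (∀ j, N' j)) (F : Set (Set ι)),
      IsUnimodularFan (L₀.prod (AddSubgroup.pi Set.univ L')) p F ∧
      (∀ i, ∃ i₀, (p i).1 = p₀ i₀) ∧
      (∀ s ∈ F, ∃ s₀ ∈ F₀, ∀ i ∈ s, ∃ i₀ ∈ s₀, (p i).1 = p₀ i₀) ∧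
      (∀ s ∈ F, ∀ i ∈ s, ∀ j, δ j ((p i).2 j) = φ j (p i).1) ∧
      fanCone p F = {y | y.1 ∈ fanCone p₀ F₀ ∧
        ∀ j, y.2 j ∈ fanCone (q j) (T j) ∧ δ j (y.2 j) = φ j y.1} := by
  obtain ⟨ι, _, p, F, hF, hs, hproj, hcone⟩ :=
    exists_fan_below (W := W) hF₀ hs₀ φ hφ Finset.univ
  let g : N × ((Σ j, W j) → ℝ) →ₗ[ℝ] N × (∀ j, N' j) :=
    LinearMap.prodMap LinearMap.id
      (LinearMap.pi fun j => ∑ w, (LinearMap.proj ⟨j, w⟩).smulRight (q j w))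
  have hg1 : ∀ y, (g y).1 = y.1 := fun y => rfl
  have hg2 : ∀ y j, (g y).2 j = ∑ w, y.2 ⟨j, w⟩ • q j w := fun y j => by simp [g]
  have hδg : ∀ y j, δ j ((g y).2 j) = ∑ w, y.2 ⟨j, w⟩ := fun y j => by
    rw [hg2]; simp [map_sum, hδ]
  -- The subfan of tight cones: every generator uses up its slack in all blocks, and the coordinates
  -- occurring in block `j` together form a face of `T j`.
  let G : Set (Set ι) := {s | s ∈ F ∧ (∀ i ∈ s, ∀ j, ∑ w, (p i).2 ⟨j, w⟩ = φ j (p i).1) ∧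
    ∀ j, {w | ∃ i ∈ s, (p i).2 ⟨j, w⟩ ≠ 0} ∈ T j}
  have hgen : ∀ i, p i ∈ fanCone p F := fun i => generator_mem_fanCone hF (hs i)
  have hsum2 : ∀ (w : ι → ℝ) a, (∑ i, w i • p i).2 a = ∑ i, w i * (p i).2 a := by
    intro w a; simp [Prod.snd_sum]
  have hsum1 : ∀ (w : ι → ℝ), (∑ i, w i • p i).1 = ∑ i, w i • (p i).1 := by
    intro w; simp [Prod.fst_sum]
  have hsupp : ∀ w : ι → ℝ, Function.support w ∈ G → ∀ j,
      Function.support (fun a => (∑ i, w i • p i).2 ⟨j, a⟩) ∈ T j := by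
    intro w hw j
    refine (hT j).down _ (hw.2.2 j) _ fun a ha => ?_
    rw [Function.mem_support, hsum2] at ha
    obtain ⟨i, -, hi⟩ := Finset.exists_ne_zero_of_sum_ne_zero ha
    exact ⟨i, left_ne_zero_of_mul hi, right_ne_zero_of_mul hi⟩
  have hGF : fanCone p G ⊆ fanCone p F := fun y ⟨w, h0, h, e⟩ => ⟨w, h0, h.1, e⟩
  have hdeg : ∀ w : ι → ℝ, Function.support w ∈ G → ∀ j,
      ∑ a, (∑ i, w i • p i).2 ⟨j, a⟩ = φ j (∑ i, w i • p i).1 := by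
    intro w hw j
    simp only [hsum2, hsum1, map_sum, map_smul, smul_eq_mul]
    rw [Finset.sum_comm]
    refine Finset.sum_congr rfl fun i _ => ?_
    by_cases h : w i = 0
    · simp [h]
    · rw [← Finset.mul_sum, hw.2.1 i h j]
  obtain ⟨hmap, hmapc⟩ := hF.map (G := G) (fun s hs => hs.1)
    ⟨hF.empty_mem, by simp, fun j => by simpa using (hT j).empty_mem⟩
    (fun s hs t hts => ⟨hF.down _ hs.1 _ hts, fun i hi => hs.2.1 i (hts hi), fun j =>
      (hT j).down _ (hs.2.2 j) _ fun a ⟨i, hi, h⟩ => ⟨i, hts hi, h⟩⟩) g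
    (L' := L₀.prod (AddSubgroup.pi Set.univ L'))
    (fun i => ⟨(hF.mem_lattice i).1, fun j _ => by
      rw [hg2]
      refine AddSubgroup.sum_mem _ fun w _ => ?_
      obtain ⟨n, hn⟩ := mem_integerLattice.1 (hF.mem_lattice i).2 ⟨j, w⟩
      rw [hn, Int.cast_smul_eq_zsmul]
      exact AddSubgroup.zsmul_mem _ ((hT j).mem_lattice w) n⟩)
    (by
      rintro y hy y' hy' heq
      have hn := hGF hy
      have hn' := hGF hy'
      rw [hcone] at hn hn'
      obtain ⟨w, -, hw, rfl⟩ := hy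
      obtain ⟨w', -, hw', rfl⟩ := hy'
      refine Prod.ext (congrArg (fun y : N × (∀ j, N' j) => y.1) heq) (funext fun ⟨j, a⟩ => ?_)
      have := congrFun (congrArg Prod.snd heq) j
      rw [hg2, hg2] at this
      exact congrFun ((hT j).inj _ _ (fun a => hn.2.1 _) (fun a => hn'.2.1 _)
        (hsupp w hw j) (hsupp w' hw' j) this) a)
    (by
      rintro w hw ⟨h1, h2⟩
      refine ⟨h1, mem_integerLattice.2 fun ⟨j, a⟩ => ?_⟩
      have := h2 j (Set.mem_univ j)
      rw [hg2] at this
      exact (hT j).integral _ (hsupp w hw j) this a)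
  have hheight : ∀ i, ∃ i₀, (g (p i)).1 = p₀ i₀ := fun i => by
    obtain ⟨s₀, -, h⟩ := hproj _ (hs i)
    obtain ⟨i₀, -, h⟩ := h i rfl
    exact ⟨i₀, h⟩
  refine ⟨ι, inferInstance, _, G, hmap, hheight, fun s hs => hproj s hs.1, fun s hs i hi j => ?_, ?_⟩
  · rw [hδg]
    exact hs.2.1 i hi j
  · rw [hmapc]
    ext ⟨x, z⟩
    constructor
    · rintro ⟨y, hy, heq⟩
      have hn := hGF hy
      rw [hcone] at hn
      obtain ⟨w, -, hw, rfl⟩ := hy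
      rw [← heq]
      exact ⟨hn.1, fun j => ⟨⟨_, fun a => hn.2.1 _, hsupp w hw j, (hg2 _ j).symm⟩, by
        rw [hδg]; exact hdeg w hw j⟩⟩
    · rintro ⟨hx, hz⟩
      simp only at hx hz
      choose t ht0 htT htz using fun j => (hz j).1
      have hz' : g (x, fun a => t a.1 a.2) = (x, z) :=
        Prod.ext rfl (funext fun j => by rw [hg2]; exact htz j)
      have hts : ∀ j, ∑ a, t j a = φ j x := fun j => by
        have := hδg (x, fun a => t a.1 a.2) j
        rw [hz'] at this
        exact this.symm.trans (hz j).2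
      have hmem : (x, fun a => t a.1 a.2) ∈ fanCone p F := by
        rw [hcone]
        exact ⟨hx, fun a => ht0 _ _, by simp, fun j => (hts j).le⟩
      refine ⟨_, ?_, hz'⟩
      obtain ⟨w, hw0, hwF, heq⟩ := hmem
      have hle : ∀ i j, ∑ a, (p i).2 ⟨j, a⟩ ≤ φ j (p i).1 := fun i j => by
        have := hgen i
        rw [hcone] at this
        exact this.2.2.2 j
      have hnn : ∀ i a, 0 ≤ (p i).2 a := fun i a => by
        have := hgen i
        rw [hcone] at this
        exact this.2.1 a
      refine ⟨w, hw0, ⟨hwF, fun i hi j => ?_, fun j => ?_⟩, heq⟩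
      -- The inequality `∑ ≤ φ j` holds at each generator. Equality for a nonnegative combination
      -- forces equality at every generator of nonzero weight.
      · have h1 : ∑ i, w i * ∑ a, (p i).2 ⟨j, a⟩ = ∑ i, w i * φ j (p i).1 := by
          have h2 := hts j
          have h3 : ∀ a, t j a = ∑ i, w i * (p i).2 ⟨j, a⟩ := fun a => by
            rw [← hsum2, heq]
          have h4 : x = ∑ i, w i • (p i).1 := by rw [← hsum1, heq]
          simp only [h3, h4, map_sum, map_smul, smul_eq_mul] at h2
          rw [Finset.sum_comm] at h2
          simpa only [Finset.mul_sum] using h2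
        have h2 := (Finset.sum_eq_sum_iff_of_le
          (fun i _ => mul_le_mul_of_nonneg_left (hle i j) (hw0 i))).1 h1 i (Finset.mem_univ i)
        exact mul_left_cancel₀ hi h2
      -- Nonnegativity rules out cancellation: a coordinate used by a generator of positive weight
      -- is also nonzero in `t j`.
      · refine (hT j).down _ (htT j) _ ?_
        rintro a ⟨i, hi, hia⟩
        have h3 : t j a = ∑ i, w i * (p i).2 ⟨j, a⟩ := by rw [← hsum2, heq]
        rw [Function.mem_support, h3]
        have hpos : 0 < w i * (p i).2 ⟨j, a⟩ :=
          mul_pos (lt_of_le_of_ne (hw0 i) (Ne.symm hi)) (lt_of_le_of_ne (hnn i _) (Ne.symm hia))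
        exact (hpos.trans_le (Finset.single_le_sum (f := fun i => w i * (p i).2 ⟨j, a⟩)
          (fun i _ => mul_nonneg (hw0 i) (hnn i _)) (Finset.mem_univ i))).ne'

end Product

/-! ### Unimodular simplices through integral weights -/

/-- The lattice `ℤ` inside `ℝ`. -/
def intLattice : AddSubgroup ℝ := (Int.castAddHom ℝ).range

theorem mem_intLattice {x : ℝ} : x ∈ intLattice ↔ ∃ n : ℤ, x = n := by
  simp only [intLattice, AddMonoidHom.mem_range, Int.coe_castAddHom, eq_comm]

theorem eq_zero_of_mul_integral {b : ℝ} (h : ∀ r : ℝ, ∃ n : ℤ, r * b = n) : b = 0 := by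
  by_contra hb
  obtain ⟨n, hn⟩ := h (1 / (2 * b))
  have h1 : (2 : ℝ) * n = 1 := by rw [← hn]; field_simp
  have h2 : 2 * n = 1 := by exact_mod_cast h1
  omega

section Simplex

variable {E : Type} [AddCommGroup E] [Module ℝ E] {L : AddSubgroup E} {s : Finset E}

theorem AffineMap.apply_eq_add_sum {k : ℕ} (f : (Fin k → ℝ) →ᵃ[ℝ] E) (x : Fin k → ℝ) :
    f x = f 0 + ∑ i, x i • (f (Pi.single i 1) - f 0) := by
  have h1 : ∀ y, f y = f.linear y + f 0 := fun y => congrFun f.decomp y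
  rw [h1 x, add_comm, LinearMap.pi_apply_eq_sum_univ f.linear x]
  congr 1
  refine Finset.sum_congr rfl fun i _ => ?_
  rw [h1 (Pi.single i 1), add_sub_cancel_right]
  congr 2
  funext j
  simp [Pi.single_apply, eq_comm]

theorem IsUnimodularSimplex.subset (hs : IsUnimodularSimplex L s) : (s : Set E) ⊆ L := by
  obtain ⟨k, f, hinj, hL, hf⟩ := hs
  rw [← hf]
  rintro _ ⟨x, hx, rfl⟩
  refine (hL x).2 (mem_integerLattice.2 fun j => ?_)
  rcases hx with rfl | ⟨i, rfl⟩
  · exact ⟨0, by simp⟩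
  · by_cases h : j = i
    · exact ⟨1, by simp [h]⟩
    · exact ⟨0, by simp [h]⟩

/-- Adding the right integer multiple of one vertex turns the combination into an affine one, whose
coordinates under the unimodular parametrization are integral. The weight of the base vertex then
follows from the total. -/
theorem IsUnimodularSimplex.integral (hs : IsUnimodularSimplex L s) {w : E → ℝ}
    (h1 : ∃ n : ℤ, ∑ v ∈ s, w v = n) (hL : ∑ v ∈ s, w v • v ∈ L) :
    ∀ v ∈ s, ∃ n : ℤ, w v = n := by
  classical
  have hsL := hs.subset
  obtain ⟨k, f, hinj, hfL, hf⟩ := hs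
  have hsum : ∀ {A : Type _} [AddCommMonoid A] (a : E → A),
      ∑ v ∈ s, a v = a (f 0) + ∑ i, a (f (Pi.single i 1)) := by
    intro A _ a
    have : s = insert (f 0) (Finset.univ.image fun i => f (Pi.single i 1)) := by
      rw [← Finset.coe_inj, ← hf, Set.image_insert_eq, ← Set.range_comp]
      simp [Function.comp_def]
    rw [this, Finset.sum_insert, Finset.sum_image]
    · intro i _ j _ hij
      have := congrFun (hinj hij) i
      by_contra hne
      simp [hne] at this
    · simp only [Finset.mem_image, Finset.mem_univ, true_and, not_exists]
      intro i hi
      have := congrFun (hinj hi) i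
      simp at this
  obtain ⟨n, hn⟩ := h1
  rw [hsum] at hn hL
  have h0 : f 0 ∈ L := hsL (by rw [← hf]; exact ⟨0, .inl rfl, rfl⟩)
  have hfx : f (fun i => w (f (Pi.single i 1))) =
      (w (f 0) • f 0 + ∑ i, w (f (Pi.single i 1)) • f (Pi.single i 1)) + (1 - n) • f 0 := by
    rw [f.apply_eq_add_sum]
    simp only [smul_sub, Finset.sum_sub_distrib, ← Finset.sum_smul]
    rw [sub_smul, one_smul, ← Int.cast_smul_eq_zsmul ℝ n, ← hn]
    module
  have hint := mem_integerLattice.1 ((hfL _).1 (hfx ▸ L.add_mem hL (L.zsmul_mem h0 _)))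
  choose b hb using hint
  intro v hv
  rw [← Finset.mem_coe, ← hf] at hv
  obtain ⟨x, rfl | ⟨i, rfl⟩, rfl⟩ := hv
  · refine ⟨n - ∑ i, b i, ?_⟩
    push_cast
    rw [← hn, ← Finset.sum_congr rfl fun i _ => hb i]
    ring
  · exact ⟨b i, hb i⟩

/-- Converse criterion. Affine independence is not assumed because integrality implies it: a linear
relation among the edges at `x₀` may be scaled by any real, and all its scaled coefficients would
have to be integers. -/
theorem isUnimodularSimplex_of_integral (hne : s.Nonempty) (hsL : (s : Set E) ⊆ L)
    (hint : ∀ w : E → ℝ, ∑ v ∈ s, w v = 1 → ∑ v ∈ s, w v • v ∈ L → ∀ v ∈ s, ∃ n : ℤ, w v = n) :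
    IsUnimodularSimplex L s := by
  classical
  obtain ⟨x₀, hx₀⟩ := hne
  let e := (s.erase x₀).equivFin
  let z : Fin (s.erase x₀).card → E := fun i => (e.symm i).1
  have hz : Function.Injective z := Subtype.val_injective.comp e.symm.injective
  have hzs : ∀ i, z i ∈ s ∧ z i ≠ x₀ := fun i =>
    ⟨Finset.mem_of_mem_erase (e.symm i).2, Finset.ne_of_mem_erase (e.symm i).2⟩
  have hsz : ∀ v ∈ s, v ≠ x₀ → ∃ i, z i = v := fun v hv hne =>
    ⟨e ⟨v, Finset.mem_erase.2 ⟨hne, hv⟩⟩, by simp [z]⟩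
  have hsum : ∀ {A : Type _} [AddCommMonoid A] (a : E → A),
      ∑ v ∈ s, a v = a x₀ + ∑ i, a (z i) := by
    intro A _ a
    rw [← Finset.add_sum_erase s a hx₀, ← Finset.sum_coe_sort, ← e.symm.sum_comp]
  let f : (Fin (s.erase x₀).card → ℝ) →ᵃ[ℝ] E :=
    (∑ i, (LinearMap.proj i : (Fin (s.erase x₀).card → ℝ) →ₗ[ℝ] ℝ).smulRight
      (z i - x₀)).toAffineMap + AffineMap.const ℝ _ x₀
  have hf : ∀ c, f c = ∑ i, c i • (z i - x₀) + x₀ := fun c => by simp [f]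
  have hfL : ∀ c, f c ∈ L → ∀ i, ∃ n : ℤ, c i = n := by
    intro c hc i
    -- The base vertex `x₀` lies outside the range of `z`, so the default value of the extension is
    -- exactly its barycentric weight.
    let w : E → ℝ := Function.extend z c fun _ => 1 - ∑ i, c i
    have hw0 : w x₀ = 1 - ∑ i, c i :=
      Function.extend_apply' _ _ _ fun ⟨i, hi⟩ => (hzs i).2 hi
    have hwz : ∀ i, w (z i) = c i := fun i => hz.extend_apply _ _ _
    rw [← hwz]
    refine hint w ?_ ?_ _ (hzs i).1
    · rw [hsum, hw0]; simp [hwz]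
    · convert! hc using 1
      rw [hsum, hw0, hf]
      simp only [hwz, smul_sub, Finset.sum_sub_distrib, ← Finset.sum_smul]
      module
  refine ⟨_, f, ?_, fun c => ⟨fun h => mem_integerLattice.2 (hfL c h), fun h => ?_⟩, ?_⟩
  · intro c c' hcc
    rw [hf, hf, add_left_inj] at hcc
    funext i
    refine sub_eq_zero.1 (eq_zero_of_mul_integral fun r => ?_)
    refine hfL (fun i => r * (c i - c' i)) ?_ i
    rw [hf]
    have : ∑ i, (r * (c i - c' i)) • (z i - x₀) = 0 := by
      simp only [mul_smul, ← Finset.smul_sum, sub_smul, Finset.sum_sub_distrib, hcc, sub_self,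
        smul_zero]
    rw [this, zero_add]
    exact hsL hx₀
  · rw [hf]
    refine L.add_mem (L.sum_mem fun i _ => ?_) (hsL hx₀)
    obtain ⟨n, hn⟩ := mem_integerLattice.1 h i
    rw [hn, Int.cast_smul_eq_zsmul]
    exact L.zsmul_mem (L.sub_mem (hsL (hzs i).1) (hsL hx₀)) n
  · have h1 : ∀ i, f (Pi.single i 1) = z i := by
      intro i
      rw [hf, Finset.sum_eq_single i]
      · simp
      · intro j _ hj; simp [hj]
      · simp
    ext v
    rw [Set.image_insert_eq, ← Set.range_comp]
    simp only [Set.mem_insert_iff, Set.mem_range, Function.comp_apply, h1, hf]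
    constructor
    · rintro (rfl | ⟨i, rfl⟩)
      · simpa using hx₀
      · exact (hzs i).1
    · intro hv
      by_cases h : v = x₀
      · exact .inl (by simp [h])
      · exact .inr (hsz v hv h)

end Simplex

/-! ### From triangulations to fans -/

section Complex

open Geometry

theorem Geometry.SimplicialComplex.exists_facet {E : Type*} [AddCommGroup E] [Module ℝ E]
    {K : SimplicialComplex ℝ E} (hK : K.faces.Finite) {f : Finset E} (hf : f ∈ K.faces) :
    ∃ g ∈ K.facets, f ⊆ g := by
  obtain ⟨g, hfg, hg⟩ := hK.exists_le_maximal hf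
  exact ⟨g, ⟨hg.1, fun t ht h => h.antisymm (hg.2 ht h)⟩, hfg⟩

/-- Weights on the vertices of two faces of a complex with the same sum and the same moment
agree. -/
theorem Geometry.SimplicialComplex.weights_unique {E : Type*} [AddCommGroup E] [Module ℝ E]
    {K : SimplicialComplex ℝ E} {f f' : Finset E} (hf : f ∈ K.faces) (hf' : f' ∈ K.faces)
    {w w' : E → ℝ} (h0 : 0 ≤ w) (h0' : 0 ≤ w') (hw : ∀ v ∉ f, w v = 0) (hw' : ∀ v ∉ f', w' v = 0)
    (h1 : ∑ v ∈ f, w v = ∑ v ∈ f', w' v) (h2 : ∑ v ∈ f, w v • v = ∑ v ∈ f', w' v • v) :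
    w = w' := by
  classical
  have hz : ∀ {g : Finset E} {u : E → ℝ}, 0 ≤ u → (∀ v ∉ g, u v = 0) → ∑ v ∈ g, u v = 0 →
      u = 0 := by
    intro g u hu hug hs
    funext v
    by_cases hv : v ∈ g
    · exact (Finset.sum_eq_zero_iff_of_nonneg fun i _ => hu i).1 hs v hv
    · exact hug v hv
  rcases (Finset.sum_nonneg fun v (_ : v ∈ f) => h0 v).eq_or_lt' with hr | hr
  · rw [hz h0 hw hr, hz h0' hw' (h1 ▸ hr)]
  set r := ∑ v ∈ f, w v with hrdef
  have hx : ∀ {g : Finset E} {u : E → ℝ}, 0 ≤ u → ∑ v ∈ g, u v = r →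
      r⁻¹ • ∑ v ∈ g, u v • v ∈ convexHull ℝ (g : Set E) := by
    intro g u hu hs
    refine Finset.mem_convexHull'.2 ⟨fun v => r⁻¹ * u v, fun v _ =>
      mul_nonneg (inv_nonneg.2 hr.le) (hu v), ?_, ?_⟩
    · rw [← Finset.mul_sum, hs, inv_mul_cancel₀ hr.ne']
    · simp only [mul_smul, Finset.smul_sum]
  -- After division by the total mass `r`, both moments are one point in both hulls, hence in the
  -- hull of the common vertices. Affine independence of each face then identifies both weight
  -- functions with `r * b`.
  have hmem := K.inter_subset_convexHull hf hf' ⟨hx h0 rfl, h2 ▸ hx h0' h1.symm⟩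
  rw [← Finset.coe_inter, Finset.mem_convexHull'] at hmem
  obtain ⟨b, hb0, hb1, hb2⟩ := hmem
  have key : ∀ {g : Finset E} {u : E → ℝ}, g ∈ K.faces → f ∩ f' ⊆ g → (∀ v ∉ g, u v = 0) →
      ∑ v ∈ g, u v = r → ∑ v ∈ g, u v • v = ∑ v ∈ f, w v • v →
      u = fun v => if v ∈ f ∩ f' then r * b v else 0 := by
    intro g u hg hsub hu hs hm
    funext v
    by_cases hv : v ∈ g
    · refine (K.indep hg).eq_of_sum_eq_sum_subtype (w₁ := u)
        (w₂ := fun v => if v ∈ f ∩ f' then r * b v else 0) ?_ ?_ v hv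
      · rw [hs, ← Finset.sum_filter, Finset.filter_mem_eq_inter, Finset.inter_eq_right.2 hsub,
          ← Finset.mul_sum, hb1, mul_one]
      · simp only [ite_smul, zero_smul]
        rw [← Finset.sum_filter, Finset.filter_mem_eq_inter, Finset.inter_eq_right.2 hsub]
        simp only [mul_smul]
        rw [← Finset.smul_sum, hb2, hm, smul_inv_smul₀ hr.ne']
    · rw [hu v hv, if_neg fun h => hv (hsub h)]
  rw [key hf Finset.inter_subset_left hw rfl rfl,
    key hf' Finset.inter_subset_right hw' h1.symm h2.symm]

theorem sum_extend_subtype {E A : Type*} [AddCommMonoid A] [Module ℝ A] {V : Set E} [Fintype V]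
    (w : V → ℝ) (a : E → A) {f : Finset E} (hf : (f : Set E) ⊆ V)
    (hw : Subtype.val '' Function.support w ⊆ (f : Set E)) :
    ∑ v ∈ f, Function.extend Subtype.val w 0 v • a v = ∑ i, w i • a i.1 := by
  classical
  rw [← Finset.sum_subtype_of_mem (p := (· ∈ V)) _ fun x hx => hf hx]
  simp only [Subtype.val_injective.extend_apply]
  refine Finset.sum_subset (Finset.subset_univ _) fun i _ hi => ?_
  have : w i = 0 := by
    by_contra h
    exact hi (Finset.mem_subtype.2 (hw ⟨i, h, rfl⟩))
  rw [this, zero_smul]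

/-- The fan over a unimodular triangulation, placed in height one. -/
theorem IsUnimodularTriangulation.exists_fan {E : Type} [AddCommGroup E] [Module ℝ E]
    {L : AddSubgroup E} {Q : Set E} {K : SimplicialComplex ℝ E}
    (hK : IsUnimodularTriangulation L Q K) :
    ∃ (ι : Type) (_ : Fintype ι) (v : ι → E) (F : Set (Set ι)),
      IsUnimodularFan (L.prod intLattice) (fun i => (v i, (1 : ℝ))) F ∧ (∀ i, {i} ∈ F) ∧
      (∀ i, v i ∈ Q) ∧ (∀ s ∈ F, s.Nonempty → ∃ f ∈ K.faces, v '' s ⊆ f) ∧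
      ∀ x r, (x, r) ∈ fanCone (fun i => (v i, (1 : ℝ))) F ↔
        (x = 0 ∧ r = 0) ∨ 0 < r ∧ ∃ y ∈ Q, x = r • y := by
  classical
  have hVfin : K.vertices.Finite := by
    rw [SimplicialComplex.vertices_eq]
    exact hK.finite.biUnion fun f _ => f.finite_toSet
  let _ : Fintype K.vertices := hVfin.fintype
  -- The empty set is added by hand: faces of a complex are nonempty, but a fan needs its apex.
  let F : Set (Set K.vertices) := {s | s = ∅ ∨ ∃ f ∈ K.faces, Subtype.val '' s ⊆ (f : Set E)}
  have hsub : ∀ f ∈ K.faces, (f : Set E) ⊆ K.vertices := fun f hf => by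
    rw [SimplicialComplex.vertices_eq]
    exact Set.subset_biUnion_of_mem (u := fun g : Finset E => (g : Set E)) hf
  have hpair : ∀ w : K.vertices → ℝ, ∑ i, w i • ((i.1, 1) : E × ℝ) = (∑ i, w i • i.1, ∑ i, w i) :=
    fun w => by
      refine Prod.ext ?_ ?_
      · simp [Prod.fst_sum]
      · simp [Prod.snd_sum]
  have hone : ∀ (w : K.vertices → ℝ) {f : Finset E}, f ∈ K.faces →
      Subtype.val '' Function.support w ⊆ (f : Set E) →
      ∑ v ∈ f, Function.extend Subtype.val w 0 v = ∑ i, w i := fun w f hf hw => by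
    simpa using sum_extend_subtype w (fun _ => (1 : ℝ)) (hsub f hf) hw
  have hmom : ∀ (w : K.vertices → ℝ) {f : Finset E}, f ∈ K.faces →
      Subtype.val '' Function.support w ⊆ (f : Set E) →
      ∑ v ∈ f, Function.extend Subtype.val w 0 v • v = ∑ i, w i • i.1 := fun w f hf hw =>
    sum_extend_subtype w id (hsub f hf) hw
  have hext0 : ∀ (w : K.vertices → ℝ), 0 ≤ w → 0 ≤ Function.extend Subtype.val w 0 := by
    intro w hw x
    by_cases hx : x ∈ K.vertices
    · have : Function.extend Subtype.val w 0 x = w ⟨x, hx⟩ :=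
        Subtype.val_injective.extend_apply w 0 ⟨x, hx⟩
      rw [this]; exact hw _
    · rw [Function.extend_apply' _ _ _ fun ⟨i, hi⟩ => hx (hi ▸ i.2)]
  have hextz : ∀ (w : K.vertices → ℝ) {f : Finset E},
      Subtype.val '' Function.support w ⊆ (f : Set E) →
      ∀ x ∉ f, Function.extend Subtype.val w 0 x = 0 := by
    intro w f hw x hx
    by_cases hxV : x ∈ K.vertices
    · have : Function.extend Subtype.val w 0 x = w ⟨x, hxV⟩ :=
        Subtype.val_injective.extend_apply w 0 ⟨x, hxV⟩
      rw [this]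
      by_contra h
      exact hx (hw ⟨⟨x, hxV⟩, h, rfl⟩)
    · rw [Function.extend_apply' _ _ _ fun ⟨i, hi⟩ => hxV (hi ▸ i.2)]; rfl
  have hspace : ∀ f ∈ K.faces, ∀ x ∈ f, x ∈ Q := fun f hf x hx =>
    hK.space_eq ▸ K.subset_space hf hx
  have hnil : ∀ w : K.vertices → ℝ, 0 ≤ w → ∑ i, w i = 0 → w = 0 := fun w hw h =>
    funext fun i => (Finset.sum_eq_zero_iff_of_nonneg fun i _ => hw i).1 h i (Finset.mem_univ i)
  refine ⟨K.vertices, inferInstance, Subtype.val, F, ⟨.inl rfl, ?_, ?_, ?_, ?_⟩, ?_, ?_, ?_, ?_⟩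
  · rintro s (rfl | ⟨f, hf, hs⟩) t hts
    · exact .inl (Set.subset_empty_iff.1 hts)
    · exact .inr ⟨f, hf, (Set.image_mono hts).trans hs⟩
  · rintro ⟨x, hx⟩
    obtain ⟨g, hg, hxg⟩ := SimplicialComplex.exists_facet hK.finite hx
    exact ⟨(hK.unimodular g hg).subset (hxg (Finset.mem_singleton_self x)),
      mem_intLattice.2 ⟨1, by simp⟩⟩
  · intro w w' h0 h0' hs hs' heq
    rw [hpair, hpair, Prod.mk.injEq] at heq
    obtain ⟨h2, h1⟩ := heq
    rcases hs with hs | ⟨f, hf, hs⟩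
    · rw [Function.support_eq_empty_iff] at hs
      subst hs
      exact (hnil w' h0' (by simpa using h1.symm)).symm
    rcases hs' with hs' | ⟨f', hf', hs'⟩
    · rw [Function.support_eq_empty_iff] at hs'
      subst hs'
      exact hnil w h0 (by simpa using h1)
    have := SimplicialComplex.weights_unique hf hf' (hext0 w h0) (hext0 w' h0') (hextz w hs)
      (hextz w' hs') (by rw [hone w hf hs, hone w' hf' hs', h1])
      (by rw [hmom w hf hs, hmom w' hf' hs', h2])
    funext i
    have := congrFun this i.1
    rwa [Subtype.val_injective.extend_apply, Subtype.val_injective.extend_apply] at this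
  · rintro w (hs | ⟨f, hf, hs⟩) hL i
    · rw [Function.support_eq_empty_iff] at hs
      exact ⟨0, by simp [hs]⟩
    · rw [hpair] at hL
      obtain ⟨g, hg, hfg⟩ := SimplicialComplex.exists_facet hK.finite hf
      have hsg : Subtype.val '' Function.support w ⊆ (g : Set E) :=
        hs.trans (Finset.coe_subset.2 hfg)
      by_cases hi : i.1 ∈ g
      · rw [← Subtype.val_injective.extend_apply w 0 i]
        refine (hK.unimodular g hg).integral ?_ ?_ _ hi
        · rw [hone w hg.1 hsg]
          exact mem_intLattice.1 hL.2
        · rw [hmom w hg.1 hsg]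
          exact hL.1
      · refine ⟨0, ?_⟩
        by_contra h
        exact hi (hsg ⟨i, by simpa using h, rfl⟩)
  · exact fun i => .inr ⟨{i.1}, i.2, by simp⟩
  · exact fun i => hspace _ i.2 _ (Finset.mem_singleton_self _)
  · rintro s (rfl | h) hne
    · exact absurd hne (by simp)
    · exact h
  · intro x r
    constructor
    · rintro ⟨w, h0, hs, heq⟩
      rw [hpair, Prod.mk.injEq] at heq
      obtain ⟨rfl, rfl⟩ := heq
      rcases (Finset.sum_nonneg fun i (_ : i ∈ Finset.univ) => h0 i).eq_or_lt' with hr | hr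
      · exact .inl ⟨by simp [hnil w h0 hr], hr⟩
      · refine .inr ⟨hr, (∑ i, w i)⁻¹ • ∑ i, w i • i.1, ?_, by rw [smul_inv_smul₀ hr.ne']⟩
        rcases hs with hs | ⟨f, hf, hs⟩
        · rw [Function.support_eq_empty_iff] at hs
          simp [hs] at hr
        rw [← hK.space_eq, SimplicialComplex.mem_space_iff]
        refine ⟨f, hf, Finset.mem_convexHull'.2
          ⟨fun v => (∑ i, w i)⁻¹ * Function.extend Subtype.val w 0 v, fun v _ =>
            mul_nonneg (inv_nonneg.2 hr.le) (hext0 w h0 v), ?_, ?_⟩⟩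
        · rw [← Finset.mul_sum, hone w hf hs, inv_mul_cancel₀ hr.ne']
        · simp only [mul_smul, ← Finset.smul_sum, hmom w hf hs]
    · rintro (⟨rfl, rfl⟩ | ⟨hr, y, hy, rfl⟩)
      · exact ⟨0, le_rfl, .inl (by simp), by rw [hpair]; simp⟩
      · rw [← hK.space_eq, SimplicialComplex.mem_space_iff] at hy
        obtain ⟨f, hf, hy⟩ := hy
        obtain ⟨b, hb0, hb1, hb2⟩ := Finset.mem_convexHull'.1 hy
        let w : K.vertices → ℝ := fun i => if i.1 ∈ f then r * b i.1 else 0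
        have hs : Subtype.val '' Function.support w ⊆ (f : Set E) := by
          rintro _ ⟨i, hi, rfl⟩
          by_contra h
          exact hi (if_neg h)
        have hwe : ∀ v ∈ f, Function.extend Subtype.val w 0 v = r * b v := fun v hv => by
          have := Subtype.val_injective.extend_apply w 0 ⟨v, hsub f hf hv⟩
          rw [show Function.extend Subtype.val w 0 v = w ⟨v, hsub f hf hv⟩ from this]
          exact if_pos hv
        refine ⟨w, fun i => ?_, .inr ⟨f, hf, hs⟩, ?_⟩
        · by_cases h : i.1 ∈ f
          · simpa [w, h] using mul_nonneg hr.le (hb0 _ h)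
          · simp [w, h]
        · rw [hpair, ← hone w hf hs, Finset.sum_congr rfl hwe, ← Finset.mul_sum, hb1, mul_one]
          rw [← hmom w hf hs, Finset.sum_congr rfl fun v hv => by rw [hwe v hv]]
          simp only [mul_smul, ← Finset.smul_sum, hb2]

end Complex

/-! ### From fans back to triangulations -/

section Dehomogenize

open Geometry

/-- Uniqueness for nonnegative weights yields linear independence on a face: a relation says that
the positive and negative parts of `w` have the same image. -/
theorem IsUnimodularFan.eq_zero {ι M : Type*} [Fintype ι] [AddCommGroup M] [Module ℝ M]
    {L : AddSubgroup M} {p : ι → M} {F : Set (Set ι)} (hF : IsUnimodularFan L p F) {w : ι → ℝ}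
    (hs : Function.support w ∈ F) (h : ∑ i, w i • p i = 0) : w = 0 := by
  have hpos : Function.support w⁺ ⊆ Function.support w := fun i hi h0 => hi (by
    rw [Pi.posPart_apply, h0, posPart_zero])
  have hneg : Function.support w⁻ ⊆ Function.support w := fun i hi h0 => hi (by
    rw [Pi.negPart_apply, h0, negPart_zero])
  have := hF.inj w⁺ w⁻ (posPart_nonneg w) (negPart_nonneg w) (hF.down _ hs _ hpos)
    (hF.down _ hs _ hneg) (by
      rw [← sub_eq_zero, ← Finset.sum_sub_distrib, ← h]
      refine Finset.sum_congr rfl fun i _ => ?_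
      rw [← sub_smul, Pi.posPart_apply, Pi.negPart_apply, posPart_sub_negPart])
  rw [← posPart_sub_negPart w, this, sub_self]

theorem sum_image_eq_sum_indicator {ι X A : Type*} [Fintype ι] [AddCommMonoid A] [Module ℝ A]
    {q : ι → X} {s : Set ι} (hq : Set.InjOn q s) {f : Finset X} (hf : q '' s = f) (w : X → ℝ)
    (a : X → A) : ∑ v ∈ f, w v • a v = ∑ i, s.indicator (fun i => w (q i)) i • a (q i) := by
  classical
  have : f = (Finset.univ.filter (· ∈ s)).image q := by
    rw [← Finset.coe_inj, ← hf]; simp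
  rw [this, Finset.sum_image fun i hi j hj h => hq (by simpa using hi) (by simpa using hj) h,
    Finset.sum_filter]
  refine Finset.sum_congr rfl fun i _ => ?_
  by_cases h : i ∈ s <;> simp [h]

theorem sum_smul_mem_convexHull {ι X : Type*} [Fintype ι] [AddCommGroup X] [Module ℝ X]
    {q : ι → X} {w : ι → ℝ} (h0 : 0 ≤ w) (h1 : ∑ i, w i = 1) {A : Set X}
    (hA : ∀ i, w i ≠ 0 → q i ∈ A) : ∑ i, w i • q i ∈ convexHull ℝ A := by
  classical
  rw [← Finset.sum_filter_of_ne (p := fun i => w i ≠ 0) fun i _ h h' => h (by rw [h', zero_smul])]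
  refine (convex_convexHull ℝ A).sum_mem (fun i _ => h0 i) ?_ fun i hi =>
    subset_convexHull ℝ A (hA i (Finset.mem_filter.1 hi).2)
  rw [Finset.sum_filter_ne_zero, h1]

/-- A unimodular fan generated in height one yields a unimodular triangulation in height one. -/
theorem IsUnimodularFan.exists_triangulation {ι X : Type} [Fintype ι] [AddCommGroup X]
    [Module ℝ X] {L : AddSubgroup X} {q : ι → X} {F : Set (Set ι)}
    (hF : IsUnimodularFan (L.prod intLattice) (fun i => (q i, (1 : ℝ))) F) :
    ∃ K : SimplicialComplex ℝ X,
      IsUnimodularTriangulation L {x | (x, (1 : ℝ)) ∈ fanCone (fun i => (q i, (1 : ℝ))) F} K ∧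
      ∀ f ∈ K.faces, ∃ s ∈ F, q '' s = f := by
  classical
  have hpair : ∀ w : ι → ℝ, ∑ i, w i • ((q i, 1) : X × ℝ) = (∑ i, w i • q i, ∑ i, w i) :=
    fun w => by
      refine Prod.ext ?_ ?_
      · simp [Prod.fst_sum]
      · simp [Prod.snd_sum]
  have hinj : ∀ s ∈ F, Set.InjOn q s := by
    intro s hs i hi j hj hij
    by_contra hne
    have := hF.eq_zero (w := Pi.single i 1 - Pi.single j 1) (hF.down _ hs _ ?_) ?_
    · have := congrFun this i
      simp [hne] at this
    · intro k hk
      by_cases hki : k = i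
      · exact hki ▸ hi
      · by_cases hkj : k = j
        · exact hkj ▸ hj
        · simp [hki, hkj] at hk
    · simp [sub_smul, Finset.sum_sub_distrib, Pi.single_apply, ite_smul, hij]
  have hind : ∀ s ∈ F, ∀ w : X → ℝ,
      Function.support (s.indicator fun i => w (q i)) ∈ F := fun s hs w =>
    hF.down _ hs _ Set.support_indicator_subset
  have hone : ∀ s ∈ F, ∀ f : Finset X, q '' s = f → ∀ w : X → ℝ,
      ∑ v ∈ f, w v = ∑ i, s.indicator (fun i => w (q i)) i := fun s hs f hf w => by
    simpa using sum_image_eq_sum_indicator (hinj s hs) hf w fun _ => (1 : ℝ)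
  have hmom : ∀ s ∈ F, ∀ f : Finset X, q '' s = f → ∀ w : X → ℝ,
      ∑ v ∈ f, w v • v = ∑ i, s.indicator (fun i => w (q i)) i • q i := fun s hs f hf w =>
    sum_image_eq_sum_indicator (hinj s hs) hf w id
  have hnn : ∀ (s : Set ι) (f : Finset X), q '' s = f → ∀ w : X → ℝ, (∀ v ∈ f, 0 ≤ w v) →
      0 ≤ s.indicator fun i => w (q i) := fun s f hf w hw i => by
    refine Set.indicator_nonneg (fun i hi => hw _ ?_) i
    rw [← Finset.mem_coe, ← hf]
    exact ⟨i, hi, rfl⟩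
  have hindep : ∀ s ∈ F, ∀ f : Finset X, q '' s = f → AffineIndependent ℝ ((↑) : f → X) := by
    intro s hs f hf
    rw [affineIndependent_iff]
    intro t w h1 h2 e he
    let W : X → ℝ := fun x => if h : x ∈ f then (if ⟨x, h⟩ ∈ t then w ⟨x, h⟩ else 0) else 0
    have hW : ∀ x : f, W x = if x ∈ t then w x else 0 := fun x => by simp [W, x.2]
    have h1' : ∑ v ∈ f, W v = 0 := by
      rw [← Finset.sum_coe_sort]
      simp only [hW]
      rw [← Finset.sum_filter, Finset.filter_mem_eq_inter, Finset.univ_inter, h1]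
    have h2' : ∑ v ∈ f, W v • v = 0 := by
      rw [← Finset.sum_coe_sort f fun v => W v • v]
      simp only [hW, ite_smul, zero_smul]
      rw [← Finset.sum_filter, Finset.filter_mem_eq_inter, Finset.univ_inter, h2]
    -- At height one, an affine relation among the points is a linear relation among the generators.
    have hz := hF.eq_zero (hind s hs W)
      (by rw [hpair, ← hone s hs f hf, ← hmom s hs f hf, h1', h2']; rfl)
    obtain ⟨i, hi, hie⟩ : e.1 ∈ q '' s := hf ▸ e.2
    have := congrFun hz i
    rw [Set.indicator_of_mem hi, hie, hW, if_pos he] at this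
    exact this
  let K : SimplicialComplex ℝ X :=
    { faces := {f | f.Nonempty ∧ ∃ s ∈ F, q '' s = f}
      isRelLowerSet_faces := by
        rintro f ⟨hne, s, hs, hf⟩
        refine ⟨hne, fun g hgf hg => ⟨hg, s ∩ q ⁻¹' g, hF.down _ hs _ Set.inter_subset_left, ?_⟩⟩
        rw [Set.image_inter_preimage, hf]
        exact Set.inter_eq_right.2 (Finset.coe_subset.2 hgf)
      indep := fun ⟨_, s, hs, hf⟩ => hindep s hs _ hf
      inter_subset_convexHull := by
        rintro f g ⟨-, s, hs, hf⟩ ⟨-, t, ht, hg⟩ x ⟨hxf, hxg⟩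
        obtain ⟨w, hw0, hw1, hw2⟩ := Finset.mem_convexHull'.1 hxf
        obtain ⟨u, hu0, hu1, hu2⟩ := Finset.mem_convexHull'.1 hxg
        -- Both barycentric expressions of `x` are conic expressions of `(x, 1)`, so they coincide
        -- and are supported on common vertices.
        have heq := hF.inj _ _ (hnn s f hf w hw0) (hnn t g hg u hu0) (hind s hs w) (hind t ht u)
          (by rw [hpair, hpair, ← hone s hs f hf, ← hone t ht g hg, ← hmom s hs f hf,
                ← hmom t ht g hg, hw1, hw2, hu1, hu2])
        rw [← hw2, hmom s hs f hf]
        refine sum_smul_mem_convexHull (hnn s f hf w hw0) (by rw [← hone s hs f hf, hw1])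
          fun i hi => ⟨?_, ?_⟩
        · rw [← hf]; exact ⟨i, Set.mem_of_indicator_ne_zero hi, rfl⟩
        · rw [heq] at hi
          rw [← hg]; exact ⟨i, Set.mem_of_indicator_ne_zero hi, rfl⟩ }
  refine ⟨K, ⟨?_, ?_, ?_⟩, fun f hf => hf.2⟩
  · refine ((Set.toFinite F).image fun s => (q '' s).toFinset).subset ?_
    rintro f ⟨-, s, hs, hf⟩
    exact ⟨s, hs, by simp [hf]⟩
  · ext x
    rw [SimplicialComplex.mem_space_iff]
    constructor
    · rintro ⟨f, ⟨-, s, hs, hf⟩, hx⟩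
      obtain ⟨w, hw0, hw1, hw2⟩ := Finset.mem_convexHull'.1 hx
      exact ⟨_, hnn s f hf w hw0, hind s hs w,
        by rw [hpair, ← hone s hs f hf, ← hmom s hs f hf, hw1, hw2]⟩
    · rintro ⟨w, h0, hs, heq⟩
      rw [hpair, Prod.mk.injEq] at heq
      obtain ⟨rfl, h1⟩ := heq
      refine ⟨(q '' Function.support w).toFinset, ⟨?_, _, hs, by simp⟩, ?_⟩
      · rw [Set.toFinset_nonempty, Set.image_nonempty, Function.support_nonempty_iff]
        rintro rfl
        simp at h1
      · exact sum_smul_mem_convexHull h0 h1 fun i hi => by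
          rw [Set.coe_toFinset]; exact ⟨i, hi, rfl⟩
  · rintro f ⟨⟨hne, s, hs, hf⟩, -⟩
    refine isUnimodularSimplex_of_integral hne ?_ ?_
    · rw [← hf]
      rintro _ ⟨i, -, rfl⟩
      exact (hF.mem_lattice i).1
    · intro w h1 hL v hv
      obtain ⟨i, hi, rfl⟩ : v ∈ q '' s := hf ▸ hv
      obtain ⟨n, hn⟩ := hF.integral _ (hind s hs w) (by
        rw [hpair, ← hone s hs f hf, ← hmom s hs f hf, h1]
        exact ⟨hL, mem_intLattice.2 ⟨1, by simp⟩⟩) i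
      exact ⟨n, by rw [← hn, Set.indicator_of_mem hi]⟩

end Dehomogenize

/-! ### Semidirect products -/

open Geometry

theorem IsLatticePolytope.convex {E : Type*} [AddCommGroup E] [Module ℝ E] {L : AddSubgroup E}
    {P : Set E} (hP : IsLatticePolytope L P) : Convex ℝ P := by
  obtain ⟨V, -, rfl⟩ := hP
  exact convex_convexHull ℝ _

section Semidirect

variable {d n : ℕ} {e : Fin n → ℕ} {Q : Set (Fin d → ℝ)} {P : ∀ i : Fin n, Set (Fin (e i) → ℝ)}
  {φ : (Fin d → ℝ) →ᵃ[ℝ] (Fin n → ℝ)}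

/-- The union is already convex: `φ` is affine, and `(s + t) • P = s • P + t • P` for convex `P` and
nonnegative `s`, `t`. -/
theorem semidirectProduct_eq (hQ : Convex ℝ Q) (hP : ∀ i, Convex ℝ (P i))
    (hφ : ∀ a ∈ Q, ∀ i, 0 ≤ φ a i) :
    semidirectProduct Q φ P = {x | x.1 ∈ Q ∧ ∀ i, x.2 i ∈ φ x.1 i • P i} := by
  have h : (⋃ a ∈ Q, {a} ×ˢ Set.pi Set.univ fun i => φ a i • P i) =
      {x : (Fin d → ℝ) × (∀ i : Fin n, Fin (e i) → ℝ) |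
        x.1 ∈ Q ∧ ∀ i, x.2 i ∈ φ x.1 i • P i} := by
    ext ⟨x, y⟩
    simp
  rw [semidirectProduct, h]
  refine Convex.convexHull_eq ?_
  rintro ⟨x, y⟩ ⟨hx, hy⟩ ⟨x', y'⟩ ⟨hx', hy'⟩ a b ha hb hab
  refine ⟨hQ hx hx' ha hb hab, fun i => ?_⟩
  have h1 : φ (a • x + b • x') i = a * φ x i + b * φ x' i := by
    rw [Convex.combo_affine_apply hab]; rfl
  change a • y i + b • y' i ∈ φ (a • x + b • x') i • P i
  rw [h1, (hP i).add_smul (mul_nonneg ha (hφ x hx i)) (mul_nonneg hb (hφ x' hx' i)), mul_smul,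
    mul_smul]
  exact Set.add_mem_add (Set.smul_mem_smul_set (hy i)) (Set.smul_mem_smul_set (hy' i))

theorem semidirectProduct_eq_empty {i : Fin n} (hi : P i = ∅) : semidirectProduct Q φ P = ∅ := by
  have : ∀ a, (Set.pi Set.univ fun i => φ a i • P i) = ∅ := fun a =>
    Set.pi_eq_empty (Set.mem_univ i) (by rw [hi, Set.smul_set_empty])
  simp [semidirectProduct, this]

theorem isUnimodularTriangulation_bot {E : Type*} [AddCommGroup E] [Module ℝ E]
    (L : AddSubgroup E) : IsUnimodularTriangulation L ∅ (⊥ : SimplicialComplex ℝ E) :=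
  ⟨Set.finite_empty, SimplicialComplex.space_bot, fun _ hs => (Set.notMem_empty _ hs.1).elim⟩

theorem exists_triangulation_semidirectProduct
    (hQ : Convex ℝ Q) (hP : ∀ i, Convex ℝ (P i)) (hφ : IsAdmissibleMap Q φ)
    {S : SimplicialComplex ℝ (Fin d → ℝ)} {T : ∀ i, SimplicialComplex ℝ (Fin (e i) → ℝ)}
    (hS : IsUnimodularTriangulation (integerLattice (Fin d)) Q S)
    (hT : ∀ i, IsUnimodularTriangulation (integerLattice (Fin (e i))) (P i) (T i)) :
    ∃ K, IsUnimodularTriangulation (productLattice d e) (semidirectProduct Q φ P) K ∧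
      Refines K (pullbackCells (LinearMap.fst ℝ (Fin d → ℝ) (∀ i : Fin n, Fin (e i) → ℝ))
        (semidirectProduct Q φ P) S) := by
  -- An empty factor is set aside because `0 • ∅` is empty, whereas the cone of a fan always
  -- contains its apex.
  by_cases hne : ∃ i, P i = ∅
  · obtain ⟨i, hi⟩ := hne
    rw [semidirectProduct_eq_empty hi]
    exact ⟨⊥, isUnimodularTriangulation_bot _, fun s hs => (Set.notMem_empty _ hs).elim⟩
  push Not at hne
  obtain ⟨ι₀, _, v₀, F₀, hF₀, hs₀, hQ₀, hface₀, hcone₀⟩ := hS.exists_fan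
  choose κ hκ v F hF hs hPv hface hcone using fun i => (hT i).exists_fan
  -- Homogenization of `φ`: the pair `(a, t)` is sent to the linear part at `a` plus `t` times `φ
  -- 0`.
  let Φ : Fin n → (Fin d → ℝ) × ℝ →ₗ[ℝ] ℝ := fun j =>
    (LinearMap.proj j ∘ₗ φ.linear).coprod (LinearMap.toSpanSingleton ℝ ℝ (φ 0 j))
  have hΦ : ∀ j a, Φ j (a, 1) = φ a j := fun j a => by
    have := congrFun (congrFun φ.decomp a) j
    simp only [Pi.add_apply] at this
    simp [Φ, this]
  have hΦnat : ∀ j i, ∃ m : ℕ, Φ j (v₀ i, 1) = m := by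
    intro j i
    have h0 := hφ.nonneg _ (hQ₀ i) j
    obtain ⟨m, hm⟩ := mem_integerLattice.1 (hφ.integral _ (hF₀.mem_lattice i).1) j
    rw [hm] at h0
    obtain ⟨k, hk⟩ := Int.eq_ofNat_of_zero_le (Int.cast_nonneg_iff.1 h0)
    exact ⟨k, by rw [hΦ, hm, hk]; simp⟩
  obtain ⟨ι, _, p, G, hG, hheight, hproj, hdeg, hGcone⟩ := exists_fan_fibreProduct hF₀ hs₀ Φ hΦnat
    hF (fun j => LinearMap.snd ℝ (Fin (e j) → ℝ) ℝ) (fun _ _ => rfl)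
  -- Forgets the heights of the factors. On the fibre product they are determined by the base point
  -- through `Φ`, so nothing is lost.
  let r : ((Fin d → ℝ) × ℝ) × (∀ j, (Fin (e j) → ℝ) × ℝ) →ₗ[ℝ]
      ((Fin d → ℝ) × (∀ j, Fin (e j) → ℝ)) × ℝ :=
    ((LinearMap.fst ℝ _ _ ∘ₗ LinearMap.fst ℝ _ _).prod (LinearMap.pi fun j =>
      LinearMap.fst ℝ _ _ ∘ₗ LinearMap.proj j ∘ₗ LinearMap.snd ℝ _ _)).prod
      (LinearMap.snd ℝ _ _ ∘ₗ LinearMap.fst ℝ _ _)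
  have hr : ∀ y, r y = ((y.1.1, fun j => (y.2 j).1), y.1.2) := fun y => rfl
  have hdegw : ∀ w : ι → ℝ, Function.support w ∈ G → ∀ j,
      ((∑ i, w i • p i).2 j).2 = Φ j (∑ i, w i • p i).1 := by
    intro w hw j
    simp only [Prod.snd_sum, Prod.fst_sum, Finset.sum_apply, map_sum]
    refine Finset.sum_congr rfl fun i _ => ?_
    by_cases h : w i = 0
    · simp [h]
    · have := hdeg _ hw i h j
      simp only [LinearMap.snd_apply] at this
      simp [this]
  obtain ⟨hmap, hmapc⟩ := hG.map subset_rfl hG.empty_mem hG.down r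
    (L' := (productLattice d e).prod intLattice)
    (fun i => ⟨⟨(hG.mem_lattice i).1.1, fun j hj => ((hG.mem_lattice i).2 j hj).1⟩,
      (hG.mem_lattice i).1.2⟩)
    (by
      intro y hy y' hy' heq
      rw [hGcone] at hy hy'
      rw [hr, hr, Prod.mk.injEq, Prod.mk.injEq] at heq
      obtain ⟨⟨h1, h2⟩, h3⟩ := heq
      have h4 : y.1 = y'.1 := Prod.ext h1 h3
      refine Prod.ext h4 (funext fun j => Prod.ext (congrFun h2 j) ?_)
      have h5 := (hy.2 j).2
      have h6 := (hy'.2 j).2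
      rw [← h4] at h6
      exact h5.trans h6.symm)
    (by
      rintro w hw ⟨⟨h1, h2⟩, h3⟩
      have hx : (∑ i, w i • p i).1 ∈ (integerLattice (Fin d)).prod intLattice := ⟨h1, h3⟩
      refine ⟨hx, fun j hj => ⟨h2 j hj, ?_⟩⟩
      change ((∑ i, w i • p i).2 j).2 ∈ intLattice
      rw [hdegw w hw]
      obtain ⟨m, hm⟩ := mem_intLattice.1 h3
      obtain ⟨k, hk⟩ := mem_integerLattice.1 (hφ.integral _ h1) j
      obtain ⟨k₀, hk₀⟩ := mem_integerLattice.1 (hφ.integral 0 (AddSubgroup.zero_mem _)) j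
      -- At height `m` the homogenization is `Φ j (a, m) = φ a j + (m - 1) * φ 0 j`, so the
      -- forgotten height is integral.
      refine mem_intLattice.2 ⟨k + (m - 1) * k₀, ?_⟩
      have h4 := hΦ j (∑ i, w i • p i).1.1
      have h5 := hΦ j 0
      have h6 : (∑ i, w i • p i).1 = ((∑ i, w i • p i).1.1, (1 : ℝ)) +
          ((m : ℝ) - 1) • ((0 : Fin d → ℝ), (1 : ℝ)) -
          ((m : ℝ) - 1) • ((0 : Fin d → ℝ), (0 : ℝ)) := by
        refine Prod.ext (by simp) ?_
        have : (∑ i, w i • p i).1.2 = m := hm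
        simp [this]
      have hk' : φ (∑ i, w i • p i).1.1 j = k := hk
      rw [h6, map_sub, map_add, map_smul, map_smul, h4, h5, hk', hk₀]
      have : Φ j ((0 : Fin d → ℝ), (0 : ℝ)) = 0 := map_zero _
      rw [this]
      push_cast
      simp)
  let q : ι → (Fin d → ℝ) × (∀ j, Fin (e j) → ℝ) := fun i => (r (p i)).1
  have hq : (fun i => r (p i)) = fun i => (q i, (1 : ℝ)) := by
    funext i
    obtain ⟨i₀, h⟩ := hheight i
    have h1 : (r (p i)).2 = 1 := congrArg Prod.snd h
    exact Prod.ext rfl h1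
  rw [hq] at hmap hmapc
  obtain ⟨K, hK, hKface⟩ := hmap.exists_triangulation
  have hone : ∀ a, (a, (1 : ℝ)) ∈ fanCone (fun i => (v₀ i, (1 : ℝ))) F₀ ↔ a ∈ Q := by
    intro a
    rw [hcone₀]
    simp
  have hlvl : ∀ j y (t : ℝ), 0 ≤ t →
      ((y, t) ∈ fanCone (fun i => (v j i, (1 : ℝ))) (F j) ↔ y ∈ t • P j) := by
    intro j y t ht
    rw [hcone]
    rcases ht.eq_or_lt' with rfl | ht
    · rw [Set.zero_smul_set (hne j)]
      simp
    · simp [ht, ht.ne', Set.mem_smul_set, eq_comm]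
  have hset : {x | (x, (1 : ℝ)) ∈ fanCone (fun i => (q i, (1 : ℝ))) G} =
      semidirectProduct Q φ P := by
    rw [semidirectProduct_eq hQ hP hφ.nonneg, hmapc, hGcone]
    ext ⟨a, y⟩
    constructor
    · rintro ⟨⟨⟨a', t⟩, z⟩, ⟨hx, hz⟩, heq⟩
      rw [hr, Prod.mk.injEq, Prod.mk.injEq] at heq
      obtain ⟨⟨rfl, rfl⟩, rfl⟩ := heq
      have ha := (hone a').1 hx
      refine ⟨ha, fun j => (hlvl j _ _ (hφ.nonneg _ ha j)).1 ?_⟩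
      rw [← hΦ, ← (hz j).2]
      exact (hz j).1
    · rintro ⟨ha, hy⟩
      refine ⟨((a, 1), fun j => (y j, φ a j)), ⟨(hone a).2 ha, fun j => ⟨?_, (hΦ j a).symm⟩⟩, rfl⟩
      exact (hlvl j _ _ (hφ.nonneg _ ha j)).2 (hy j)
  rw [hset] at hK
  refine ⟨K, hK, fun f hf => ?_⟩
  obtain ⟨s, hsG, hsf⟩ := hKface f hf
  obtain ⟨s₀, hs₀F, hss₀⟩ := hproj s hsG
  have hsne : s.Nonempty := by
    rw [← Set.image_nonempty (f := q), hsf]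
    exact SimplicialComplex.nonempty_of_mem_faces hf
  obtain ⟨f₀, hf₀, hsf₀⟩ := hface₀ s₀ hs₀F (by
    obtain ⟨i, hi⟩ := hsne
    obtain ⟨i₀, hi₀, -⟩ := hss₀ i hi
    exact ⟨i₀, hi₀⟩)
  obtain ⟨g, hg, hfg⟩ := SimplicialComplex.exists_facet hS.finite hf₀
  refine ⟨_, ⟨g, hg, rfl⟩, Set.subset_inter ?_ ?_⟩
  · rw [← hK.space_eq]
    exact SimplicialComplex.convexHull_subset_space hf
  -- The vertices of `f` project to vertices of one face of `S`, so the whole simplex projects into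
  -- a facet containing that face.
  · refine convexHull_min ?_ ((convex_convexHull ℝ _).linear_preimage _)
    rw [← hsf]
    rintro _ ⟨i, hi, rfl⟩
    obtain ⟨i₀, hi₀, h⟩ := hss₀ i hi
    refine subset_convexHull ℝ _ (hfg ?_)
    have : (q i).1 = v₀ i₀ := congrArg Prod.fst h
    exact hsf₀ ⟨i₀, hi₀, this.symm⟩

end Semidirect

/-! ### Nested polytopes and the theorem -/

theorem IsLatticePolytope.finite_extremePoints {κ : Type*}
    {L : AddSubgroup (κ → ℝ)} {Q : Set (κ → ℝ)} (hQ : IsLatticePolytope L Q) :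
    (Set.extremePoints ℝ Q).Finite := by
  obtain ⟨V, -, rfl⟩ := hQ
  exact V.finite_toSet.subset extremePoints_convexHull_subset

theorem IsLatticePolytope.convexHull_extremePoints {κ : Type*} [Fintype κ]
    {L : AddSubgroup (κ → ℝ)} {Q : Set (κ → ℝ)} (hQ : IsLatticePolytope L Q) :
    convexHull ℝ (Set.extremePoints ℝ Q) = Q := by
  have hc : IsCompact Q := by
    obtain ⟨V, -, rfl⟩ := hQ
    exact V.finite_toSet.isCompact_convexHull ℝ
  have hcl : IsClosed (convexHull ℝ (Set.extremePoints ℝ Q)) :=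
    hQ.finite_extremePoints.isClosed_convexHull ℝ
  rw [← hcl.closure_eq, closure_convexHull_extremePoints hc hQ.convex]

/-- For fixed `z i ∈ P i` the map `v ↦ (v, (v i • z i)_i)` is linear. A convex expression of `a` by
vertices of `Q` is therefore carried to one of the point of the semidirect product over `a`. -/
theorem nestedPolytope_eq_semidirectProduct {n : ℕ} {e : Fin n → ℕ} {L : AddSubgroup (Fin n → ℝ)}
    {Q : Set (Fin n → ℝ)} (hQ : IsLatticePolytope L Q) (P : ∀ i : Fin n, Set (Fin (e i) → ℝ)) :
    nestedPolytope Q P = semidirectProduct Q (AffineMap.id ℝ _) P := by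
  refine (convexHull_mono (Set.biUnion_subset_biUnion_left extremePoints_subset)).antisymm
    (convexHull_min ?_ (convex_convexHull ℝ _))
  rintro ⟨a, y⟩ hx
  obtain ⟨a, ha, rfl, hy⟩ : ∃ a' ∈ Q, a = a' ∧ ∀ i, y i ∈ a i • P i := by simpa using hx
  choose z hzP hz using hy
  have hfin := hQ.finite_extremePoints
  rw [← hQ.convexHull_extremePoints, ← hfin.coe_toFinset, Finset.mem_convexHull'] at ha
  obtain ⟨w, hw0, hw1, hw2⟩ := ha
  have heq : ((a, y) : (Fin n → ℝ) × (∀ i : Fin n, Fin (e i) → ℝ)) =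
      ∑ v ∈ hfin.toFinset, w v • (v, fun i => v i • z i) := by
    refine Prod.ext ?_ (funext fun i => ?_)
    · simp [Prod.fst_sum, hw2]
    · have h1 : y i = a i • z i := (hz i).symm
      rw [Prod.snd_sum, Finset.sum_apply]
      change y i = ∑ v ∈ hfin.toFinset, w v • v i • z i
      rw [h1, ← hw2]
      simp [Finset.sum_smul, mul_smul]
  rw [heq]
  refine (convex_convexHull ℝ _).sum_mem hw0 hw1 fun v hv => subset_convexHull ℝ _ ?_
  exact Set.mem_biUnion (hfin.mem_toFinset.1 hv)
    ⟨rfl, fun i _ => Set.smul_mem_smul_set (hzP i)⟩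

theorem mainTheorem10 :
    -- one factor, with refinement of the pull-back
    (∀ (d e : ℕ) (Q : Set (Fin d → ℝ)) (P : Set (Fin e → ℝ))
        (φ : (Fin d → ℝ) →ᵃ[ℝ] (Fin 1 → ℝ)),
      IsLatticePolytope (integerLattice (Fin d)) Q →
      IsLatticePolytope (integerLattice (Fin e)) P →
      IsAdmissibleMap Q φ →
      ∀ (S : Geometry.SimplicialComplex ℝ (Fin d → ℝ))
        (T : Geometry.SimplicialComplex ℝ (Fin e → ℝ)),
      IsUnimodularTriangulation (integerLattice (Fin d)) Q S →
      IsUnimodularTriangulation (integerLattice (Fin e)) P T →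
      ∃ K : Geometry.SimplicialComplex ℝ ((Fin d → ℝ) × (Fin 1 → Fin e → ℝ)),
        IsUnimodularTriangulation (productLattice d fun _ : Fin 1 => e)
          (semidirectProduct (e := fun _ : Fin 1 => e) Q φ fun _ => P) K ∧
        Refines K
          (pullbackCells (LinearMap.fst ℝ (Fin d → ℝ) (Fin 1 → Fin e → ℝ))
            (semidirectProduct (e := fun _ : Fin 1 => e) Q φ fun _ => P) S)) ∧
    -- several factors
    (∀ (d n : ℕ) (e : Fin n → ℕ) (Q : Set (Fin d → ℝ)) (P : ∀ i : Fin n, Set (Fin (e i) → ℝ))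
        (φ : (Fin d → ℝ) →ᵃ[ℝ] (Fin n → ℝ)),
      IsLatticePolytope (integerLattice (Fin d)) Q →
      (∀ i, IsLatticePolytope (integerLattice (Fin (e i))) (P i)) →
      IsAdmissibleMap Q φ →
      (∃ S, IsUnimodularTriangulation (integerLattice (Fin d)) Q S) →
      (∀ i, ∃ T, IsUnimodularTriangulation (integerLattice (Fin (e i))) (P i) T) →
      ∃ K, IsUnimodularTriangulation (productLattice d e) (semidirectProduct Q φ P) K) ∧
    -- nested configurations
    (∀ (d k : ℕ) (e : Fin (d + 1) → ℕ) (Q : Set (Fin (d + 1) → ℝ))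
        (P : ∀ i : Fin (d + 1), Set (Fin (e i) → ℝ)),
      IsLatticePolytope (integerLattice (Fin (d + 1))) Q →
      Q ⊆ (k : ℝ) • stdSimplex ℝ (Fin (d + 1)) →
      (∀ i, IsLatticePolytope (integerLattice (Fin (e i))) (P i)) →
      (∃ S, IsUnimodularTriangulation (integerLattice (Fin (d + 1))) Q S) →
      (∀ i, ∃ T, IsUnimodularTriangulation (integerLattice (Fin (e i))) (P i) T) →
      ∃ K, IsUnimodularTriangulation (productLattice (d + 1) e) (nestedPolytope Q P) K) := by
  have several : ∀ (d n : ℕ) (e : Fin n → ℕ) (Q : Set (Fin d → ℝ))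
      (P : ∀ i : Fin n, Set (Fin (e i) → ℝ)) (φ : (Fin d → ℝ) →ᵃ[ℝ] (Fin n → ℝ)),
      IsLatticePolytope (integerLattice (Fin d)) Q →
      (∀ i, IsLatticePolytope (integerLattice (Fin (e i))) (P i)) →
      IsAdmissibleMap Q φ →
      (∃ S, IsUnimodularTriangulation (integerLattice (Fin d)) Q S) →
      (∀ i, ∃ T, IsUnimodularTriangulation (integerLattice (Fin (e i))) (P i) T) →
      ∃ K, IsUnimodularTriangulation (productLattice d e) (semidirectProduct Q φ P) K := by
    rintro d n e Q P φ hQ hP hφ ⟨S, hS⟩ hT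
    choose T hT using hT
    obtain ⟨K, hK, -⟩ :=
      exists_triangulation_semidirectProduct hQ.convex (fun i => (hP i).convex) hφ hS hT
    exact ⟨K, hK⟩
  refine ⟨?_, several, ?_⟩
  · intro d e Q P φ hQ hP hφ S T hS hT
    exact exists_triangulation_semidirectProduct (e := fun _ : Fin 1 => e) hQ.convex
      (fun _ => hP.convex) hφ hS (fun _ => hT)
  · intro d k e Q P hQ hk hP hS hT
    rw [nestedPolytope_eq_semidirectProduct hQ]
    -- The inclusion in the dilated simplex serves only to make the coordinates nonnegative on `Q`.
    refine several _ _ e Q P _ hQ hP ⟨fun x hx => hx, fun a ha i => ?_⟩ hS hT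
    obtain ⟨x, hx, rfl⟩ := hk ha
    exact mul_nonneg k.cast_nonneg (hx.1 i)
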